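/- **Theorem 10.1.** Let $N\ge 1$. Let $U(N)$ be the group of $N\times N$ unitary matrices, $\sigma$ its Haar probability measure, $I$ the identity matrix, and $\|M\|=\bigl(\sum_{i,j}|m_{ij}|^2\bigr)^{1/2}$ the Hilbert--Schmidt norm. Let $H(N)$ be the real vector space of $N\times N$ complex Hermitian matrices, and let $\lambda$ be Lebesgue measure on $H(N)$, i.e. the image of Lebesgue measure on $\mathbb{R}^{N^2}$ under the map sending real parameters $(y_{jj})_{1\le j\le N}$, $(z_{jk})_{1\le j<k\le N}$, $(w_{jk})_{1\le j<k\le N}$ to the Hermitian matrix with diagonal entries $y_{jj}$ and entries $(z_{jk}+\mathrm{i}w_{jk})/\sqrt2$ at $(j,k)$ for $j<k$ (this map is isometric from the Euclidean to the Hilbert--Schmidt norm). For $r>0$ put $$B(I,r)=\{V\in U(N):\|I-V\|\le r\},\qquad b(0,r)=\{G\in H(N):\|G\|\le r\},\qquad C_N=\frac{\prod_{j=1}^{N-1}j!}{(2\pi)^{N(N+1)/2}}.$$ There exists $r_0>0$, depending only on $N$, such that the following hold. 1. For every Borel measurable $f:U(N)\to[0,\infty)$ and every $0<r\le r_0$,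 $$(2-e^{6r})^{N^2}C_N\int_{b(0,r)}f(e^{\mathrm{i}H})\,d\lambda(H)\;\le\;\int_{B(I,2r)}f(U)\,d\sigma(U)\;\le\; e^{6rN^2}C_N\int_{b(0,3r)}f(e^{\mathrm{i}H})\,d\lambda(H).$$ 2. More generally, for every $n\ge1$, every Borel measurable $f:U(N)^n\to[0,\infty)$ and every $0<r\le r_0$ (with the same $r_0$), $$(2-e^{6r})^{N^2n}C_N^n\int_{b(0,r)^n}f(e^{\mathrm{i}H_1},\dots,e^{\mathrm{i}H_n})\,d\lambda(H_1)\cdots d\lambda(H_n)\le\int_{B(I,2r)^n}f(U_1,\dots,U_n)\,d\sigma(U_1)\cdots d\sigma(U_n)$$ $$\le e^{6rN^2n}C_N^n\int_{b(0,3r)^n}f(e^{\mathrm{i}H_1},\dots,e^{\mathrm{i}H_n})\,d\lambda(H_1)\cdots d\lambda(H_n).$$ All integrals are integrals of nonnegative functions with values in $[0,\infty]$. -/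

import Mathlib

open MeasureTheory
open scoped NNReal ENNReal

noncomputable section

namespace LieIntegration

/-- The unitary group `U(N)`, with the topology inherited from the space of matrices. -/
abbrev UGroup (N : ℕ) : Type := Matrix.unitaryGroup (Fin N) ℂ

/-- The real vector space `H(N)` of `N × N` complex Hermitian matrices. -/
abbrev Herm (N : ℕ) : Type := selfAdjoint (Matrix (Fin N) (Fin N) ℂ)

instance (N : ℕ) : MeasurableSpace (UGroup N) := borel _

instance (N : ℕ) : BorelSpace (UGroup N) := ⟨rfl⟩

instance (N : ℕ) : MeasurableSpace (Herm N) := borel _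

instance (N : ℕ) : BorelSpace (Herm N) := ⟨rfl⟩

instance (N : ℕ) : CompactSpace (UGroup N) := by
  refine isCompact_iff_compactSpace.mp ?_
  have hK : IsCompact (Set.univ.pi fun _ : Fin N => Set.univ.pi fun _ : Fin N =>
      Metric.closedBall (0 : ℂ) 1) :=
    isCompact_univ_pi fun _ => isCompact_univ_pi fun _ => isCompact_closedBall _ _
  refine IsCompact.of_isClosed_subset (X := Matrix (Fin N) (Fin N) ℂ) hK ?_ ?_
  · have h : ((Matrix.unitaryGroup (Fin N) ℂ : Submonoid _) : Set (Matrix (Fin N) (Fin N) ℂ))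
        = {U | U * star U = 1} := by
      ext U
      exact Matrix.mem_unitaryGroup_iff
    change IsClosed ((Matrix.unitaryGroup (Fin N) ℂ : Submonoid _) :
      Set (Matrix (Fin N) (Fin N) ℂ))
    rw [h]
    exact isClosed_eq (continuous_id.mul continuous_star) continuous_const
  · intro U hU i _ j _
    simpa using entry_norm_bound_of_unitary hU i j

/-- The Haar measure `σ` on `U(N)`, normalized to be a probability measure. -/
def haarU (N : ℕ) : Measure (UGroup N) := Measure.haarMeasure ⊤

open scoped Matrix.Norms.Frobenius in
/-- The Hilbert–Schmidt (Frobenius) norm of a complex matrix. -/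
def hsNorm {N : ℕ} (M : Matrix (Fin N) (Fin N) ℂ) : ℝ := ‖M‖

/-- The closed Hilbert–Schmidt ball `B(U, r)` in `U(N)`. -/
def ballU {N : ℕ} (U : UGroup N) (r : ℝ) : Set (UGroup N) :=
  {V | hsNorm (U.1 - V.1) ≤ r}

/-- The closed Hilbert–Schmidt ball `b(H, r)` in `H(N)`. -/
def ballH {N : ℕ} (H : Herm N) (r : ℝ) : Set (Herm N) :=
  {G | hsNorm (H.1 - G.1) ≤ r}

/-- The Hermitian matrix with real parameters `y j j`, and `z j k`, `w j k` for `j < k`.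
The `N²` parameters are stored in one array `x`: `y j j = x (j, j)` and, for `j < k`,
`z j k = x (j, k)` and `w j k = x (k, j)`. The entry at `(j, k)` with `j < k` is
`(z j k + i w j k) / √2`. -/
def hermOfCoords {N : ℕ} (x : Fin N × Fin N → ℝ) : Herm N :=
  ⟨Matrix.of fun j k =>
      if j = k then (x (j, j) : ℂ)
      else if j < k then ((x (j, k) : ℂ) + Complex.I * (x (k, j) : ℂ)) / (Real.sqrt 2 : ℂ)
      else ((x (k, j) : ℂ) - Complex.I * (x (j, k) : ℂ)) / (Real.sqrt 2 : ℂ), by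
    rw [selfAdjoint.mem_iff]
    ext j k
    rw [Matrix.star_apply, Matrix.of_apply, Matrix.of_apply]
    rcases lt_trichotomy j k with h | h | h
    · simp [h, h.ne, h.ne', h.not_gt, sub_eq_add_neg]
    · subst h; simp
    · simp [h, h.ne, h.ne', h.not_gt, sub_eq_add_neg]⟩

theorem continuous_hermOfCoords (N : ℕ) : Continuous (hermOfCoords (N := N)) := by
  refine Continuous.subtype_mk (continuous_matrix fun j k => ?_) _
  simp only [Matrix.of_apply]
  split_ifs <;> fun_prop

/-- Lebesgue measure `λ` on `H(N)`: the image of Lebesgue measure on `ℝ^(N²)` under the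
parametrization `hermOfCoords`, which is isometric for the Hilbert–Schmidt norm. -/
def lebesgueH (N : ℕ) : Measure (Herm N) :=
  (volume : Measure (Fin N × Fin N → ℝ)).map hermOfCoords

/-- The map `H ↦ e^{iH}` from `H(N)` to `U(N)`. -/
def expI {N : ℕ} (H : Herm N) : UGroup N :=
  ⟨NormedSpace.exp (Complex.I • (H : Matrix (Fin N) (Fin N) ℂ)), by
    rw [Matrix.mem_unitaryGroup_iff, Matrix.star_eq_conjTranspose, ← Matrix.exp_conjTranspose]
    have hH : (H : Matrix (Fin N) (Fin N) ℂ).conjTranspose = H := H.2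
    have h : (Complex.I • (H : Matrix (Fin N) (Fin N) ℂ)).conjTranspose
        = -(Complex.I • (H : Matrix (Fin N) (Fin N) ℂ)) := by
      rw [Matrix.conjTranspose_smul, hH]
      simp
    rw [h, ← Matrix.exp_add_of_commute _ _
      (Commute.refl (Complex.I • (H : Matrix (Fin N) (Fin N) ℂ))).neg_right]
    simp⟩

/-- The constant `C_N = (∏_{j=1}^{N-1} j!) / (2π)^{N(N+1)/2}`. -/
def constC (N : ℕ) : ℝ :=
  (∏ j ∈ Finset.Icc 1 (N - 1), (j.factorial : ℝ)) / (2 * Real.pi) ^ (N * (N + 1) / 2)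

end LieIntegration

end

open LieIntegration

/-!
Write `μ` for `N²`-dimensional Hausdorff measure, normalized to agree with Lebesgue measure on
Euclidean space. Lebesgue measure on `H(N)` is `μ` because `hermOfCoords` is an isometry, and Haar
measure on `U(N)` is `c • μ` for some constant `c` because translations are isometries. On the ball
of radius `ρ` the power series of the exponential gives
`(2 - e^ρ) ‖H - G‖ ≤ ‖e^{iH} - e^{iG}‖ ≤ e^ρ ‖H - G‖`, so `H ↦ e^{iH}` distorts `μ` by a factor
between `(2 - e^ρ)^(N²)` and `e^(ρN²)`; the asserted inequalities follow once `c = C_N`.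

To find `c`, consider the chart `(X, H) ↦ (1 + X) e^{iH}` of the space of all matrices near `1`,
with `X` lower triangular with real diagonal. Its derivative at the origin has determinant `±1`, so
it asymptotically preserves the volume of a product of small boxes. On the other hand the image of
such a box is the set of all `T U` with `U = e^{iH}` and `T` lower triangular with positive diagonal
near `1`. Revealing its rows one at a time, Fubini and unitary invariance show that its volume is
the Haar measure of the set of `U` times an explicit product of volumes of shells.
-/

noncomputable section

namespace LieIntegration

open Filter Topology Measure Module Set
open scoped Matrix Matrix.Norms.Frobenius

section Exponential

variable {𝔸 : Type*} [NormedRing 𝔸] {X Y : 𝔸} {ρ : ℝ}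

theorem norm_pow_succ_sub_pow_succ_le (hX : ‖X‖ ≤ ρ) (hY : ‖Y‖ ≤ ρ) (n : ℕ) :
    ‖X ^ (n + 1) - Y ^ (n + 1)‖ ≤ (n + 1) * ρ ^ n * ‖X - Y‖ := by
  have hρ : 0 ≤ ρ := (norm_nonneg X).trans hX
  induction n with
  | zero => simp
  | succ n ih =>
    have hYn : ‖Y ^ (n + 1)‖ ≤ ρ ^ (n + 1) :=
      (norm_pow_le' Y n.succ_pos).trans (pow_le_pow_left₀ (norm_nonneg _) hY _)
    calc ‖X ^ (n + 1 + 1) - Y ^ (n + 1 + 1)‖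
        = ‖X * (X ^ (n + 1) - Y ^ (n + 1)) + (X - Y) * Y ^ (n + 1)‖ := by
          rw [pow_succ' X (n + 1), pow_succ' Y (n + 1)]; noncomm_ring
      _ ≤ ‖X‖ * ‖X ^ (n + 1) - Y ^ (n + 1)‖ + ‖X - Y‖ * ‖Y ^ (n + 1)‖ :=
          (norm_add_le _ _).trans (add_le_add (norm_mul_le _ _) (norm_mul_le _ _))
      _ ≤ ρ * ((n + 1) * ρ ^ n * ‖X - Y‖) + ‖X - Y‖ * ρ ^ (n + 1) := by gcongr
      _ = ((n + 1 : ℕ) + 1) * ρ ^ (n + 1) * ‖X - Y‖ := by push_cast; ring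

variable [NormedAlgebra ℝ 𝔸] [CompleteSpace 𝔸]

theorem norm_exp_sub_exp_sub_le (hX : ‖X‖ ≤ ρ) (hY : ‖Y‖ ≤ ρ) :
    ‖NormedSpace.exp X - NormedSpace.exp Y - (X - Y)‖ ≤ (Real.exp ρ - 1) * ‖X - Y‖ := by
  have hexp := (hasSum_nat_add_iff' 2).2 ((NormedSpace.exp_series_hasSum_exp' (𝕂 := ℝ) X).sub
    (NormedSpace.exp_series_hasSum_exp' (𝕂 := ℝ) Y))
  have hρ : HasSum (fun n : ℕ => ρ ^ n / n.factorial) (Real.exp ρ) := by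
    rw [Real.exp_eq_exp_ℝ]; exact NormedSpace.expSeries_div_hasSum_exp ρ
  have hbound := ((hasSum_nat_add_iff' 1).2 hρ).mul_right ‖X - Y‖
  simp only [Finset.sum_range_succ, Finset.sum_range_zero, Nat.factorial, pow_zero, pow_one,
    Nat.cast_one, inv_one, one_smul, sub_self, zero_add, mul_one, div_one] at hexp hbound
  refine hexp.norm_le_of_bounded hbound fun n => ?_
  rw [← smul_sub, norm_smul, norm_inv, Real.norm_natCast]
  calc ((((n + 2).factorial : ℕ) : ℝ))⁻¹ * ‖X ^ (n + 2) - Y ^ (n + 2)‖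
      ≤ ((((n + 2).factorial : ℕ) : ℝ))⁻¹ * (((n + 1 : ℕ) + 1) * ρ ^ (n + 1) * ‖X - Y‖) := by
        gcongr
        exact norm_pow_succ_sub_pow_succ_le hX hY (n + 1)
    _ = ρ ^ (n + 1) / ((n + 1).factorial : ℕ) * ‖X - Y‖ := by
        rw [Nat.factorial_succ (n + 1)]
        push_cast
        field_simp

theorem norm_exp_sub_exp_le (hX : ‖X‖ ≤ ρ) (hY : ‖Y‖ ≤ ρ) :
    ‖NormedSpace.exp X - NormedSpace.exp Y‖ ≤ Real.exp ρ * ‖X - Y‖ := by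
  linarith [norm_exp_sub_exp_sub_le hX hY,
    norm_sub_norm_le (NormedSpace.exp X - NormedSpace.exp Y) (X - Y)]

theorem le_norm_exp_sub_exp (hX : ‖X‖ ≤ ρ) (hY : ‖Y‖ ≤ ρ) :
    (2 - Real.exp ρ) * ‖X - Y‖ ≤ ‖NormedSpace.exp X - NormedSpace.exp Y‖ := by
  have h := norm_sub_norm_le (X - Y) (NormedSpace.exp X - NormedSpace.exp Y)
  rw [norm_sub_rev (X - Y) (_ - _)] at h
  linarith [norm_exp_sub_exp_sub_le hX hY]

theorem exp_injOn_closedBall (hρ : Real.exp ρ < 2) :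
    InjOn (NormedSpace.exp : 𝔸 → 𝔸) (Metric.closedBall 0 ρ) := by
  intro X hX Y hY hXY
  have h := le_norm_exp_sub_exp (mem_closedBall_zero_iff.1 hX) (mem_closedBall_zero_iff.1 hY)
  rw [hXY, sub_self, norm_zero] at h
  exact sub_eq_zero.1 (norm_le_zero_iff.1 (nonpos_of_mul_nonpos_right h (by linarith)))

theorem star_eq_neg_of_exp_mem_unitary [StarRing 𝔸] [NormedStarGroup 𝔸] (hρ : Real.exp ρ < 2)
    (hX : ‖X‖ ≤ ρ) (hU : NormedSpace.exp X ∈ unitary 𝔸) : star X = -X := by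
  refine exp_injOn_closedBall hρ (by simpa using hX) (by simpa using hX) ?_
  rw [← NormedSpace.star_exp]
  have hright : NormedSpace.exp X * NormedSpace.exp (-X) = 1 := by
    rw [← NormedSpace.exp_add_of_commute_of_mem_ball (𝕂 := ℝ) (Commute.refl X).neg_right,
      add_neg_cancel, NormedSpace.exp_zero]
    all_goals simp [NormedSpace.expSeries_radius_eq_top]
  exact left_inv_eq_right_inv (Unitary.mem_iff.1 hU).1 hright

end Exponential

section Metric

variable {N : ℕ}

-- `UGroup N` and `Herm N` carry the entrywise topology, which is the Frobenius one only by
-- unfolding, too deep for instance search.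
instance borelSpace_metric_unitary : @BorelSpace (UGroup N) (Subtype.metricSpace
    (α := Matrix (Fin N) (Fin N) ℂ)).toPseudoMetricSpace.toUniformSpace.toTopologicalSpace _ :=
  ⟨rfl⟩

instance borelSpace_metric_herm : @BorelSpace (Herm N) (AddSubgroup.normedAddCommGroup
    (E := Matrix (Fin N) (Fin N) ℂ)).toPseudoMetricSpace.toUniformSpace.toTopologicalSpace _ :=
  ⟨rfl⟩

theorem unitary_dist_eq (U V : UGroup N) : dist U V = ‖U.1 - V.1‖ := by
  rw [Subtype.dist_eq, dist_eq_norm]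

theorem ballH_eq_closedBall (H : Herm N) (r : ℝ) : ballH H r = Metric.closedBall H r := by
  ext G
  rw [Metric.mem_closedBall', dist_eq_norm]
  rfl

theorem ballU_eq_closedBall (U : UGroup N) (r : ℝ) : ballU U r = Metric.closedBall U r := by
  ext V
  rw [Metric.mem_closedBall', unitary_dist_eq]
  rfl

theorem frobenius_norm_sq_eq_trace (A : Matrix (Fin N) (Fin N) ℂ) :
    ((‖A‖ ^ 2 : ℝ) : ℂ) = (star A * A).trace := by
  rw [Matrix.frobenius_norm_def, ← Real.sqrt_eq_rpow, Real.sq_sqrt (by positivity)]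
  simp only [Real.rpow_two, Matrix.trace, Matrix.diag, Matrix.mul_apply, Matrix.star_apply]
  rw [Finset.sum_comm]
  push_cast
  refine Finset.sum_congr rfl fun i _ => Finset.sum_congr rfl fun j _ => ?_
  rw [← Complex.conj_mul']
  rfl

theorem frobenius_norm_unitary_mul (U : UGroup N) (M : Matrix (Fin N) (Fin N) ℂ) :
    ‖U.1 * M‖ = ‖M‖ := by
  have h : ((‖U.1 * M‖ ^ 2 : ℝ) : ℂ) = ((‖M‖ ^ 2 : ℝ) : ℂ) := by
    rw [frobenius_norm_sq_eq_trace, frobenius_norm_sq_eq_trace, star_mul, mul_assoc,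
      ← mul_assoc (star U.1), Matrix.mem_unitaryGroup_iff'.1 U.2, one_mul]
  exact (sq_eq_sq₀ (norm_nonneg _) (norm_nonneg _)).1 (Complex.ofReal_injective h)

instance isIsometricSMul_unitary : IsIsometricSMul (UGroup N) (UGroup N) :=
  ⟨fun U => Isometry.of_dist_eq fun V W => by
    rw [unitary_dist_eq, unitary_dist_eq]
    change ‖U.1 * V.1 - U.1 * W.1‖ = _
    rw [← mul_sub, frobenius_norm_unitary_mul]⟩

end Metric

section Coordinates

variable {N : ℕ}

theorem hermOfCoords_sub (x y : Fin N × Fin N → ℝ) :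
    hermOfCoords (x - y) = hermOfCoords x - hermOfCoords y := by
  ext j k
  simp only [hermOfCoords, Matrix.of_apply, AddSubgroupClass.coe_sub, Matrix.sub_apply,
    Pi.sub_apply]
  split_ifs <;> push_cast <;> ring

theorem hermOfCoords_surjective : Function.Surjective (hermOfCoords (N := N)) := by
  intro H
  refine ⟨fun p => if p.1 = p.2 then (H.1 p.1 p.1).re
    else if p.1 < p.2 then Real.sqrt 2 * (H.1 p.1 p.2).re
    else Real.sqrt 2 * (H.1 p.2 p.1).im, ?_⟩
  have hH : ∀ j k, star (H.1 k j) = H.1 j k := fun j k => congrFun₂ H.2 j k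
  ext j k
  simp only [hermOfCoords, Matrix.of_apply]
  rcases lt_trichotomy j k with h | rfl | h
  · simp only [h.ne, h.ne', h, h.not_gt, if_false, if_true]
    apply Complex.ext <;> simp [field]
  · simpa using Complex.conj_eq_iff_re.1 (hH j j)
  · simp only [h.ne, h.ne', h, h.not_gt, if_false, if_true]
    rw [← hH j k]
    apply Complex.ext <;> simp [field]

theorem norm_sq_hermOfCoords_apply (x : Fin N × Fin N → ℝ) (j k : Fin N) :
    ‖(hermOfCoords x).1 j k‖ ^ 2 = (x (j, k) ^ 2 + x (k, j) ^ 2) / 2 := by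
  have hsqrt : Real.sqrt 2 ^ 2 = 2 := Real.sq_sqrt two_pos.le
  simp only [hermOfCoords, Matrix.of_apply]
  split_ifs with h
  · simp [h]
  all_goals
    rw [norm_div, div_pow, Complex.sq_norm, Complex.normSq_apply, Complex.norm_real,
      Real.norm_eq_abs, sq_abs, hsqrt]
    simp [← sq, add_comm]

theorem norm_hermOfCoords (x : Fin N × Fin N → ℝ) : ‖hermOfCoords x‖ = ‖WithLp.toLp 2 x‖ := by
  have hsymm : ∑ j, ∑ k, x (k, j) ^ 2 = ∑ j, ∑ k, x (j, k) ^ 2 := Finset.sum_comm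
  change ‖(hermOfCoords x).1‖ = _
  rw [Matrix.frobenius_norm_def, EuclideanSpace.norm_eq, Real.sqrt_eq_rpow, Fintype.sum_prod_type]
  simp only [Real.rpow_two, Real.norm_eq_abs, sq_abs, norm_sq_hermOfCoords_apply,
    ← Finset.sum_div, Finset.sum_add_distrib, hsymm]
  ring_nf

theorem isometry_hermOfCoords :
    Isometry fun x : EuclideanSpace ℝ (Fin N × Fin N) => hermOfCoords x.ofLp :=
  Isometry.of_dist_eq fun x y => by
    rw [dist_eq_norm x, dist_eq_norm, ← hermOfCoords_sub, norm_hermOfCoords]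
    rfl

/-- The parametrization `hermOfCoords` as an isometry, with the Euclidean norm on `ℝ^(N²)`. -/
def hermIsometryEquiv (N : ℕ) : EuclideanSpace ℝ (Fin N × Fin N) ≃ᵢ Herm N where
  toEquiv := Equiv.ofBijective _
    ⟨isometry_hermOfCoords.injective, hermOfCoords_surjective.comp (WithLp.ofLp_surjective 2)⟩
  isometry_toFun := isometry_hermOfCoords

theorem measurePreserving_hermIsometryEquiv :
    MeasurePreserving (hermIsometryEquiv N) volume (lebesgueH N) := by
  refine ⟨(hermIsometryEquiv N).continuous.measurable, ?_⟩
  rw [lebesgueH, ← (PiLp.volume_preserving_ofLp (Fin N × Fin N)).map_eq,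
    Measure.map_map (continuous_hermOfCoords N).measurable (by fun_prop)]
  rfl

theorem lebesgueH_eq_euclideanHausdorffMeasure : lebesgueH N = μHE[N ^ 2] := by
  have hd : finrank ℝ (EuclideanSpace ℝ (Fin N × Fin N)) = N ^ 2 := by simp [sq]
  rw [← measurePreserving_hermIsometryEquiv.map_eq,
    ← InnerProductSpace.euclideanHausdorffMeasure_eq_volume, hd]
  exact ((hermIsometryEquiv N).measurePreserving_euclideanHausdorffMeasure _).map_eq

theorem lebesgueH_closedBall (r : ℝ) : lebesgueH N (Metric.closedBall 0 r)
    = volume (Metric.closedBall (0 : EuclideanSpace ℝ (Fin N × Fin N)) r) := by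
  have hzero : hermIsometryEquiv N 0 = 0 := by
    have h := hermOfCoords_sub (0 : Fin N × Fin N → ℝ) 0
    rwa [sub_self, sub_self] at h
  rw [← measurePreserving_hermIsometryEquiv.measure_preimage
    Metric.isClosed_closedBall.nullMeasurableSet, ← hzero, IsometryEquiv.preimage_closedBall,
    IsometryEquiv.symm_apply_apply]

instance sigmaFinite_lebesgueH : SigmaFinite (lebesgueH N) := by
  rw [← measurePreserving_hermIsometryEquiv.map_eq]
  exact (hermIsometryEquiv N).toHomeomorph.toMeasurableEquiv.sigmaFinite_map

instance properSpace_herm : ProperSpace (Herm N) :=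
  (hermIsometryEquiv N).isometry.antilipschitz.properSpace (hermIsometryEquiv N).continuous
    (hermIsometryEquiv N).surjective

end Coordinates

section ExponentialMap

variable {N : ℕ} {ρ : ℝ}

theorem exp_one_quarter_lt : Real.exp (1 / 4) < 4 / 3 :=
  (Real.exp_bound_div_one_sub_of_interval' (by norm_num) (by norm_num)).trans_eq (by norm_num)

theorem continuous_expI : Continuous (expI (N := N)) :=
  ((NormedSpace.exp_continuous (𝔸 := Matrix (Fin N) (Fin N) ℂ)).comp
    (continuous_subtype_val.const_smul Complex.I)).subtype_mk _

theorem expI_zero : expI (0 : Herm N) = 1 := by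
  ext1
  simp [expI]

theorem norm_I_smul_coe (H : Herm N) : ‖Complex.I • H.1‖ = ‖H‖ := by
  rw [norm_smul, Complex.norm_I, one_mul]
  rfl

theorem dist_expI_le {H G : Herm N} (hH : ‖H‖ ≤ ρ) (hG : ‖G‖ ≤ ρ) :
    dist (expI H) (expI G) ≤ Real.exp ρ * dist H G := by
  rw [unitary_dist_eq, dist_eq_norm, ← norm_I_smul_coe (H - G), AddSubgroupClass.coe_sub, smul_sub]
  exact norm_exp_sub_exp_le ((norm_I_smul_coe H).trans_le hH) ((norm_I_smul_coe G).trans_le hG)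

theorem le_dist_expI {H G : Herm N} (hH : ‖H‖ ≤ ρ) (hG : ‖G‖ ≤ ρ) :
    (2 - Real.exp ρ) * dist H G ≤ dist (expI H) (expI G) := by
  rw [unitary_dist_eq, dist_eq_norm, ← norm_I_smul_coe (H - G), AddSubgroupClass.coe_sub, smul_sub]
  exact le_norm_exp_sub_exp ((norm_I_smul_coe H).trans_le hH) ((norm_I_smul_coe G).trans_le hG)

theorem exists_expI_eq_of_exp_eq {X : Matrix (Fin N) (Fin N) ℂ} {U : UGroup N}
    (hρ : Real.exp ρ < 2) (hX : ‖X‖ ≤ ρ) (hU : NormedSpace.exp X = U.1) :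
    ∃ H : Herm N, ‖H‖ ≤ ρ ∧ expI H = U := by
  have hskew : star X = -X := star_eq_neg_of_exp_mem_unitary hρ hX (hU ▸ U.2)
  have hherm : (-Complex.I) • X ∈ selfAdjoint (Matrix (Fin N) (Fin N) ℂ) := by
    rw [selfAdjoint.mem_iff, star_smul, hskew]
    simp
  have hX' : Complex.I • (-Complex.I) • X = X := by simp [smul_smul]
  refine ⟨⟨_, hherm⟩, ?_, Subtype.ext ((congrArg NormedSpace.exp hX').trans hU)⟩
  rwa [← norm_I_smul_coe, hX']

theorem image_expI_mem_nhds (hρ₀ : 0 < ρ) (hρ : Real.exp ρ < 2) :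
    expI '' Metric.closedBall (0 : Herm N) ρ ∈ 𝓝 1 := by
  have hderiv : HasStrictFDerivAt (NormedSpace.exp : Matrix (Fin N) (Fin N) ℂ → _)
      ((ContinuousLinearEquiv.refl ℂ (Matrix (Fin N) (Fin N) ℂ) :
        Matrix (Fin N) (Fin N) ℂ →L[ℂ] Matrix (Fin N) (Fin N) ℂ)) 0 :=
    hasStrictFDerivAt_exp_zero
  have hmem := image_mem_map (m := NormedSpace.exp)
    (Metric.closedBall_mem_nhds (0 : Matrix (Fin N) (Fin N) ℂ) hρ₀)
  rw [hderiv.map_nhds_eq_of_equiv, NormedSpace.exp_zero] at hmem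
  filter_upwards [continuous_subtype_val.continuousAt (x := (1 : UGroup N)) hmem]
    with U ⟨X, hX, hXU⟩
  obtain ⟨H, hH, rfl⟩ := exists_expI_eq_of_exp_eq hρ (mem_closedBall_zero_iff.1 hX) hXU
  exact mem_image_of_mem _ (mem_closedBall_zero_iff.2 hH)

theorem exists_ballU_subset_image_expI (N : ℕ) : ∃ η : ℝ, 0 < η ∧ ∀ r ≤ η,
    ballU (1 : UGroup N) (2 * r) ⊆ expI '' ballH 0 (3 * r) := by
  have hq := exp_one_quarter_lt
  obtain ⟨η, hη, hsub⟩ := Metric.nhds_basis_closedBall.mem_iff.1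
    (image_expI_mem_nhds (N := N) (ρ := 1 / 4) (by norm_num) (by linarith))
  refine ⟨η / 2, by positivity, fun r hr U hU => ?_⟩
  rw [ballU_eq_closedBall] at hU
  obtain ⟨H, hH, rfl⟩ := hsub (Metric.closedBall_subset_closedBall (by linarith) hU)
  have hle := le_dist_expI (mem_closedBall_zero_iff.1 hH) (norm_zero.trans_le (by norm_num))
  rw [expI_zero, dist_zero_right] at hle
  refine mem_image_of_mem _ ?_
  rw [ballH_eq_closedBall, mem_closedBall_zero_iff]
  nlinarith [Metric.mem_closedBall.1 hU, norm_nonneg H]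

theorem image_expI_ballH_subset {r : ℝ} (hr : r ≤ 1 / 4) :
    expI '' ballH 0 r ⊆ ballU (1 : UGroup N) (2 * r) := by
  rintro _ ⟨H, hH, rfl⟩
  rw [ballH_eq_closedBall, mem_closedBall_zero_iff] at hH
  have hexp : Real.exp r ≤ 2 := by linarith [Real.exp_le_exp.2 hr, exp_one_quarter_lt]
  rw [ballU_eq_closedBall, Metric.mem_closedBall]
  calc dist (expI H) 1 = dist (expI H) (expI 0) := by rw [expI_zero]
    _ ≤ Real.exp r * dist H 0 :=
        dist_expI_le hH (norm_zero.trans_le ((norm_nonneg H).trans hH))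
    _ ≤ 2 * r := by rw [dist_zero_right]; gcongr

end ExponentialMap

section HausdorffMeasure

section Lipschitz

variable {X Y : Type*} [EMetricSpace X] [MeasurableSpace X] [BorelSpace X] [EMetricSpace Y]
  [MeasurableSpace Y] [BorelSpace Y] {f : X → Y} {s : Set X} {K : ℝ≥0}

theorem euclideanHausdorffMeasure_image_le (hf : LipschitzOnWith K f s) (d : ℕ) :
    μHE[d] (f '' s) ≤ (K : ℝ≥0∞) ^ d * μHE[d] s := by
  simp only [euclideanHausdorffMeasure_def, Measure.smul_apply, mul_smul_comm]
  gcongr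
  simpa using hf.hausdorffMeasure_image_le d.cast_nonneg

theorem le_euclideanHausdorffMeasure_image (hf : AntilipschitzWith K (s.domRestrict f)) (d : ℕ) :
    μHE[d] s ≤ (K : ℝ≥0∞) ^ d * μHE[d] (f '' s) := by
  have h := hf.le_hausdorffMeasure_image d.cast_nonneg univ
  rw [← (isometry_subtype_coe (s := s)).hausdorffMeasure_image (Or.inl d.cast_nonneg)] at h
  simp only [euclideanHausdorffMeasure_def, Measure.smul_apply, mul_smul_comm]
  gcongr
  simpa only [image_univ, range_domRestrict, Subtype.range_coe, ENNReal.rpow_natCast] using h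

end Lipschitz

variable {N : ℕ} {ρ : ℝ} {A : Set (Herm N)}

theorem euclideanHausdorffMeasure_image_expI_le (hA : A ⊆ Metric.closedBall 0 ρ) :
    μHE[N ^ 2] (expI '' A) ≤ ENNReal.ofReal (Real.exp ρ) ^ N ^ 2 * lebesgueH N A := by
  rw [lebesgueH_eq_euclideanHausdorffMeasure]
  refine euclideanHausdorffMeasure_image_le (LipschitzOnWith.of_dist_le_mul fun H hH G hG => ?_) _
  rw [Real.coe_toNNReal _ (Real.exp_nonneg _)]
  exact dist_expI_le (mem_closedBall_zero_iff.1 (hA hH)) (mem_closedBall_zero_iff.1 (hA hG))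

theorem le_euclideanHausdorffMeasure_image_expI (hρ : Real.exp ρ < 2)
    (hA : A ⊆ Metric.closedBall 0 ρ) :
    ENNReal.ofReal (2 - Real.exp ρ) ^ N ^ 2 * lebesgueH N A ≤ μHE[N ^ 2] (expI '' A) := by
  have hpos : 0 < 2 - Real.exp ρ := by linarith
  have hanti : AntilipschitzWith (2 - Real.exp ρ).toNNReal⁻¹ (A.domRestrict expI) :=
    AntilipschitzWith.of_le_mul_dist fun H G => by
      rw [NNReal.coe_inv, Real.coe_toNNReal _ hpos.le, ← div_eq_inv_mul, le_div_iff₀' hpos]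
      exact le_dist_expI (mem_closedBall_zero_iff.1 (hA H.2)) (mem_closedBall_zero_iff.1 (hA G.2))
  rw [lebesgueH_eq_euclideanHausdorffMeasure]
  have h := le_euclideanHausdorffMeasure_image hanti (N ^ 2)
  rwa [ENNReal.coe_inv (Real.toNNReal_pos.2 hpos).ne', ← ENNReal.inv_pow, ← ENNReal.div_eq_inv_mul,
    ENNReal.le_div_iff_mul_le (.inl (by simp [hρ.not_ge])) (.inl (by simp)), mul_comm] at h

instance isMulLeftInvariant_unitary_euclideanHausdorffMeasure (d : ℕ) :
    (μHE[d] : Measure (UGroup N)).IsMulLeftInvariant := by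
  rw [euclideanHausdorffMeasure_def]
  infer_instance

instance isHaarMeasure_unitary_euclideanHausdorffMeasure :
    (μHE[N ^ 2] : Measure (UGroup N)).IsHaarMeasure := by
  have hexp : Real.exp (1 / 4) < 2 := by linarith [exp_one_quarter_lt]
  have hball : (0 : ℝ) < 1 / 4 := by norm_num
  refine isHaarMeasure_of_isCompact_nonempty_interior _ _
    ((isCompact_closedBall (0 : Herm N) (1 / 4)).image continuous_expI)
    ⟨1, mem_interior_iff_mem_nhds.2 (image_expI_mem_nhds hball hexp)⟩ (ne_of_gt ?_) (ne_of_lt ?_)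
  · refine lt_of_lt_of_le ?_ (le_euclideanHausdorffMeasure_image_expI hexp Subset.rfl)
    rw [lebesgueH_closedBall]
    exact ENNReal.mul_pos (pow_ne_zero _ (ENNReal.ofReal_pos.2 (by linarith)).ne')
      (Metric.measure_closedBall_pos _ _ hball).ne'
  · refine (euclideanHausdorffMeasure_image_expI_le Subset.rfl).trans_lt ?_
    rw [lebesgueH_closedBall]
    exact ENNReal.mul_lt_top (by finiteness) measure_closedBall_lt_top

instance secondCountableTopology_unitary : SecondCountableTopology (UGroup N) :=
  have : SecondCountableTopology (Matrix (Fin N) (Fin N) ℂ) :=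
    inferInstanceAs (SecondCountableTopology (Fin N → Fin N → ℂ))
  TopologicalSpace.Subtype.secondCountableTopology _

instance isHaarMeasure_haarU : (haarU N).IsHaarMeasure :=
  inferInstanceAs (haarMeasure ⊤).IsHaarMeasure

theorem exists_haarU_eq_smul (N : ℕ) : ∃ c : ℝ≥0, haarU N = c • μHE[N ^ 2] :=
  ⟨_, isMulLeftInvariant_eq_smul _ _⟩

theorem tendsto_haarU_image_expI_div {c : ℝ≥0} (hc : haarU N = c • μHE[N ^ 2]) {ι : Type*}
    {l : Filter ι} {K : ι → Set (Herm N)} {ρ : ι → ℝ} (hρ : Tendsto ρ l (𝓝 0))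
    (hK : ∀ i, K i ⊆ Metric.closedBall 0 (ρ i)) (hK₀ : ∀ᶠ i in l, lebesgueH N (K i) ≠ 0) :
    Tendsto (fun i => haarU N (expI '' K i) / lebesgueH N (K i)) l (𝓝 c) := by
  have hexp : Tendsto (fun i => Real.exp (ρ i)) l (𝓝 1) :=
    Real.exp_zero ▸ (Real.continuous_exp.tendsto 0).comp hρ
  have hlow : Tendsto (fun i => ENNReal.ofReal (2 - Real.exp (ρ i)) ^ N ^ 2) l (𝓝 1) := by
    simpa [show (2 : ℝ) - 1 = 1 by norm_num] using
      ENNReal.Tendsto.pow (n := N ^ 2) (ENNReal.tendsto_ofReal (hexp.const_sub 2))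
  have hupp : Tendsto (fun i => ENNReal.ofReal (Real.exp (ρ i)) ^ N ^ 2) l (𝓝 1) := by
    simpa using ENNReal.Tendsto.pow (n := N ^ 2) (ENNReal.tendsto_ofReal hexp)
  have hfin : ∀ i, lebesgueH N (K i) ≠ ⊤ := fun i => ne_top_of_le_ne_top
    ((lebesgueH_closedBall (ρ i)).trans_ne measure_closedBall_lt_top.ne) (measure_mono (hK i))
  have hratio : Tendsto (fun i => μHE[N ^ 2] (expI '' K i) / lebesgueH N (K i)) l (𝓝 1) := by
    refine tendsto_of_tendsto_of_tendsto_of_le_of_le' hlow hupp ?_ ?_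
    · filter_upwards [hK₀, hexp.eventually_lt_const one_lt_two] with i hi hi'
      rw [ENNReal.le_div_iff_mul_le (.inl hi) (.inl (hfin i))]
      exact le_euclideanHausdorffMeasure_image_expI hi' (hK i)
    · exact .of_forall fun i =>
        ENNReal.div_le_of_le_mul (euclideanHausdorffMeasure_image_expI_le (hK i))
  have h := ENNReal.Tendsto.const_mul (a := (c : ℝ≥0∞)) hratio (.inl one_ne_zero)
  simpa only [hc, Measure.smul_apply, ENNReal.smul_def, smul_eq_mul, mul_div_assoc, mul_one] using h

end HausdorffMeasure

section UnitaryRows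

theorem measurePreserving_of_abs_det_eq_one {E : Type*} [NormedAddCommGroup E] [NormedSpace ℝ E]
    [FiniteDimensional ℝ E] [MeasurableSpace E] [BorelSpace E] (μ : Measure E)
    [μ.IsAddHaarMeasure] {f : E →ₗ[ℝ] E} (hf : |LinearMap.det f| = 1) :
    MeasurePreserving f μ μ where
  measurable := f.continuous_of_finiteDimensional.measurable
  map_eq := by
    have hdet : LinearMap.det f ≠ 0 := fun h => by simp [h] at hf
    rw [map_linearMap_addHaar_eq_smul_addHaar μ hdet, abs_inv, hf, inv_one, ENNReal.ofReal_one,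
      one_smul]

variable {N : ℕ}

theorem measurePreserving_vecMul (U : UGroup N) :
    MeasurePreserving (fun x : Fin N → ℂ => x ᵥ* U.1) := by
  have hdet : ‖U.1.det‖ = 1 := CStarRing.norm_of_mem_unitary (Matrix.det_of_mem_unitary U.2)
  have h := measurePreserving_of_abs_det_eq_one (volume : Measure (Fin N → ℂ))
    (f := (Matrix.toLin' U.1ᵀ).restrictScalars ℝ) <| by
      rw [LinearMap.det_restrictScalars, LinearMap.det_toLin', Matrix.det_transpose,
        Algebra.norm_complex_apply, Complex.normSq_eq_norm_sq, hdet, one_pow, abs_one]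
  simpa only [LinearMap.coe_restrictScalars, Matrix.toLin'_apply', Matrix.coe_mulVecLin,
    funext (Matrix.mulVec_transpose U.1)] using h

theorem vecMul_star_vecMul (x : Fin N → ℂ) (U : UGroup N) : (x ᵥ* star U.1) ᵥ* U.1 = x := by
  rw [Matrix.vecMul_vecMul, Matrix.mem_unitaryGroup_iff'.1 U.2, Matrix.vecMul_one]

theorem vecMul_vecMul_star (x : Fin N → ℂ) (U : UGroup N) : (x ᵥ* U.1) ᵥ* star U.1 = x := by
  rw [Matrix.vecMul_vecMul, Matrix.mem_unitaryGroup_iff.1 U.2, Matrix.vecMul_one]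

theorem vecMul_star_mul (x : Fin N → ℂ) (U V : UGroup N) :
    x ᵥ* star (U * V).1 = (x ᵥ* star V.1) ᵥ* star U.1 := by
  rw [Matrix.vecMul_vecMul, ← star_mul]
  rfl

theorem vecMul_star_apply_eq_of_row_eq {A B : Matrix (Fin N) (Fin N) ℂ} {j : Fin N}
    (h : A.row j = B.row j) (x : Fin N → ℂ) : (x ᵥ* star A) j = (x ᵥ* star B) j :=
  congrArg (fun v => x ⬝ᵥ star v) h

theorem vecMul_congr {A B : Matrix (Fin N) (Fin N) ℂ} {y : Fin N → ℂ}
    (h : ∀ j, y j = 0 ∨ A.row j = B.row j) : y ᵥ* A = y ᵥ* B := by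
  rw [Matrix.vecMul_eq_sum, Matrix.vecMul_eq_sum]
  refine Finset.sum_congr rfl fun j _ => ?_
  rcases h j with hj | hj
  · rw [hj, zero_smul, zero_smul]
  · exact congrArg (y j • ·) hj

theorem sum_norm_sq_vecMul_star (x : Fin N → ℂ) (U : UGroup N) :
    ∑ j, ‖(x ᵥ* star U.1) j‖ ^ 2 = ∑ j, ‖x j‖ ^ 2 := by
  have hdot (y : Fin N → ℂ) : ((∑ j, ‖y j‖ ^ 2 : ℝ) : ℂ) = y ⬝ᵥ star y := by
    push_cast
    exact Finset.sum_congr rfl fun j _ => (Complex.mul_conj' (y j)).symm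
  apply Complex.ofReal_injective
  rw [hdot, hdot, Matrix.star_vecMul, Matrix.star_eq_conjTranspose,
    Matrix.conjTranspose_conjTranspose, Matrix.dotProduct_mulVec, ← Matrix.star_eq_conjTranspose,
    vecMul_star_vecMul]

theorem sum_Iio_add_sum_Ici (f : Fin N → ℝ) (k : Fin N) :
    ∑ j ∈ Finset.Iio k, f j + ∑ j ∈ Finset.Ici k, f j = ∑ j, f j := by
  rw [← Finset.sum_filter_add_sum_filter_not Finset.univ (· < k)]
  congr 2 <;> ext <;> simp

theorem sum_Ici_norm_sq_vecMul_star_congr {U V : UGroup N} {k : Fin N}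
    (h : ∀ j < k, U.1.row j = V.1.row j) (x : Fin N → ℂ) :
    ∑ j ∈ Finset.Ici k, ‖(x ᵥ* star U.1) j‖ ^ 2 = ∑ j ∈ Finset.Ici k, ‖(x ᵥ* star V.1) j‖ ^ 2 := by
  have hU := sum_Iio_add_sum_Ici (fun j => ‖(x ᵥ* star U.1) j‖ ^ 2) k
  have hV := sum_Iio_add_sum_Ici (fun j => ‖(x ᵥ* star V.1) j‖ ^ 2) k
  have hlt : ∑ j ∈ Finset.Iio k, ‖(x ᵥ* star U.1) j‖ ^ 2 =
      ∑ j ∈ Finset.Iio k, ‖(x ᵥ* star V.1) j‖ ^ 2 :=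
    Finset.sum_congr rfl fun j hj => by
      rw [vecMul_star_apply_eq_of_row_eq (h j (Finset.mem_Iio.1 hj))]
  rw [sum_norm_sq_vecMul_star] at hU hV
  linarith

theorem exists_unitary_row_eq {s : Set (Fin N)} {w : Fin N → EuclideanSpace ℂ (Fin N)}
    (hw : Orthonormal ℂ (s.domRestrict w)) : ∃ W : UGroup N, ∀ i ∈ s, W.1.row i = (w i).ofLp := by
  obtain ⟨b, hb⟩ := hw.exists_orthonormalBasis_extension_of_card_eq (by simp)
  have hmem : (Matrix.of fun i => (b i).ofLp) ∈ Matrix.unitaryGroup (Fin N) ℂ := by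
    rw [Matrix.mem_unitaryGroup_iff]
    ext i j
    rw [Matrix.one_apply]
    simp only [eq_comm (a := i)]
    rw [← orthonormal_iff_ite.1 b.orthonormal j i, EuclideanSpace.inner_eq_star_dotProduct]
    rfl
  exact ⟨⟨_, hmem⟩, fun i hi => congrArg WithLp.ofLp (hb i hi)⟩

end UnitaryRows

section Shell

variable (ι : Type*) [Fintype ι] [Nonempty ι]

theorem volume_sum_norm_sq_le {r : ℝ} (hr : 0 ≤ r) :
    volume {x : ι → ℂ | ∑ i, ‖x i‖ ^ 2 ≤ r ^ 2} = ENNReal.ofReal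
      (r ^ (2 * Fintype.card ι) * (Real.pi ^ Fintype.card ι / (Fintype.card ι).factorial)) := by
  have h := Complex.volume_sum_rpow_le ι (p := 2) one_le_two r
  rw [div_self two_ne_zero, one_add_one_eq_two, Real.Gamma_two, mul_one,
    mul_div_cancel_left₀ _ two_ne_zero, Real.Gamma_nat_eq_factorial, ← ENNReal.ofReal_pow hr,
    ← ENNReal.ofReal_mul (by positivity)] at h
  simpa only [← Real.sqrt_eq_rpow, Real.rpow_two, Real.sqrt_le_left hr] using h

theorem volume_sum_norm_sq_lt {r : ℝ} (hr : 0 < r) :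
    volume {x : ι → ℂ | ∑ i, ‖x i‖ ^ 2 < r ^ 2} = ENNReal.ofReal
      (r ^ (2 * Fintype.card ι) * (Real.pi ^ Fintype.card ι / (Fintype.card ι).factorial)) := by
  have h := Complex.volume_sum_rpow_lt ι (p := 2) one_le_two r
  rw [div_self two_ne_zero, one_add_one_eq_two, Real.Gamma_two, mul_one,
    mul_div_cancel_left₀ _ two_ne_zero, Real.Gamma_nat_eq_factorial, ← ENNReal.ofReal_pow hr.le,
    ← ENNReal.ofReal_mul (by positivity)] at h
  simpa only [← Real.sqrt_eq_rpow, Real.rpow_two, Real.sqrt_lt' hr] using h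

theorem volume_sum_norm_sq_mem_Icc {a b : ℝ} (ha : 0 < a) (hab : a ≤ b) :
    volume {x : ι → ℂ | ∑ i, ‖x i‖ ^ 2 ∈ Icc (a ^ 2) (b ^ 2)} = ENNReal.ofReal
      ((b ^ (2 * Fintype.card ι) - a ^ (2 * Fintype.card ι)) *
        (Real.pi ^ Fintype.card ι / (Fintype.card ι).factorial)) := by
  have hset : {x : ι → ℂ | ∑ i, ‖x i‖ ^ 2 ∈ Icc (a ^ 2) (b ^ 2)} =
      {x : ι → ℂ | ∑ i, ‖x i‖ ^ 2 ≤ b ^ 2} \ {x : ι → ℂ | ∑ i, ‖x i‖ ^ 2 < a ^ 2} := by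
    ext x
    simp [and_comm]
  have hmeas : MeasurableSet {x : ι → ℂ | ∑ i, ‖x i‖ ^ 2 < a ^ 2} :=
    measurableSet_lt (by fun_prop) measurable_const
  have hsub : {x : ι → ℂ | ∑ i, ‖x i‖ ^ 2 < a ^ 2} ⊆ {x : ι → ℂ | ∑ i, ‖x i‖ ^ 2 ≤ b ^ 2} :=
    fun x hx => (mem_ofPred_eq ▸ hx : _ < _).le.trans (by gcongr)
  have hlt := volume_sum_norm_sq_lt ι ha
  rw [hset, measure_sdiff hsub hmeas.nullMeasurableSet (hlt ▸ ENNReal.ofReal_ne_top), hlt,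
    volume_sum_norm_sq_le ι (ha.le.trans hab), ← ENNReal.ofReal_sub _ (by positivity), sub_mul]

end Shell

section TriangularRows

variable {N : ℕ} {ε : ℝ} {k : Fin N}

/-- The possible `k`-th rows of a lower triangular matrix with diagonal entries in `[1, 1 + ε]` and
entries of modulus at most `ε` below the diagonal. -/
def triRow (ε : ℝ) (k : Fin N) : Set (Fin N → ℂ) :=
  {y | (∀ j < k, ‖y j‖ ≤ ε) ∧ y k ∈ Complex.ofReal '' Icc 1 (1 + ε) ∧ ∀ j, k < j → y j = 0}

/-- The vectors that a unitary transformation of the coordinates `j ≥ k` can move into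
`triRow ε k`. -/
def sliceSet (ε : ℝ) (k : Fin N) : Set (Fin N → ℂ) :=
  {y | (∀ j < k, ‖y j‖ ≤ ε) ∧ ∑ j ∈ Finset.Ici k, ‖y j‖ ^ 2 ∈ Icc (1 ^ 2) ((1 + ε) ^ 2)}

theorem isClosed_triRow (ε : ℝ) (k : Fin N) : IsClosed (triRow ε k) := by
  have hset : triRow ε k = (⋂ j ∈ Iio k, {y | ‖y j‖ ≤ ε}) ∩
      (((fun y : Fin N → ℂ => y k) ⁻¹' (Complex.ofReal '' Icc 1 (1 + ε))) ∩
        ⋂ j ∈ Ioi k, {y | y j = 0}) := by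
    ext y
    simp [triRow]
  rw [hset]
  refine .inter (isClosed_biInter fun j _ => isClosed_le (by fun_prop) continuous_const)
    (.inter (.preimage (continuous_apply k) ?_)
      (isClosed_biInter fun j _ => isClosed_eq (continuous_apply j) continuous_const))
  exact (isCompact_Icc.image Complex.continuous_ofReal).isClosed

theorem isClosed_sliceSet (ε : ℝ) (k : Fin N) : IsClosed (sliceSet ε k) := by
  have hset : sliceSet ε k = (⋂ j ∈ Iio k, {y | ‖y j‖ ≤ ε}) ∩
      (fun y : Fin N → ℂ => ∑ j ∈ Finset.Ici k, ‖y j‖ ^ 2) ⁻¹' Icc (1 ^ 2) ((1 + ε) ^ 2) := by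
    ext y
    simp [sliceSet]
  rw [hset]
  exact .inter (isClosed_biInter fun j _ => isClosed_le (by fun_prop) continuous_const)
    (isClosed_Icc.preimage (by fun_prop))

theorem sum_Ici_norm_sq_of_mem_triRow {y : Fin N → ℂ} (hy : y ∈ triRow ε k) :
    ∑ j ∈ Finset.Ici k, ‖y j‖ ^ 2 = ‖y k‖ ^ 2 := by
  refine Finset.sum_eq_single_of_mem k (Finset.mem_Ici.2 le_rfl) fun j hj hjk => ?_
  rw [hy.2.2 j (lt_of_le_of_ne (Finset.mem_Ici.1 hj) hjk.symm), norm_zero, zero_pow two_ne_zero]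

theorem triRow_subset_sliceSet : triRow ε k ⊆ sliceSet ε k := by
  intro y hy
  obtain ⟨s, hs, hsy⟩ := hy.2.1
  refine ⟨hy.1, ?_⟩
  rw [sum_Ici_norm_sq_of_mem_triRow hy, ← hsy, Complex.norm_real, Real.norm_eq_abs, sq_abs]
  constructor <;> nlinarith [hs.1, hs.2]

theorem vecMul_star_mem_sliceSet_congr {U V : UGroup N} (h : ∀ j < k, U.1.row j = V.1.row j)
    (x : Fin N → ℂ) : x ᵥ* star U.1 ∈ sliceSet ε k ↔ x ᵥ* star V.1 ∈ sliceSet ε k := by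
  refine and_congr (forall₂_congr fun j hj => ?_) ?_
  · rw [vecMul_star_apply_eq_of_row_eq (h j hj)]
  · rw [sum_Ici_norm_sq_vecMul_star_congr h]

theorem vecMul_star_eq_of_mem_triRow {U V : UGroup N} {x : Fin N → ℂ}
    (hU : x ᵥ* star U.1 ∈ triRow ε k) (hV : x ᵥ* star V.1 ∈ triRow ε k)
    (h : ∀ j < k, U.1.row j = V.1.row j) : x ᵥ* star U.1 = x ᵥ* star V.1 := by
  funext j
  rcases lt_trichotomy j k with hj | rfl | hj
  · exact vecMul_star_apply_eq_of_row_eq (h j hj) x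
  · have hnorm := sum_Ici_norm_sq_vecMul_star_congr h x
    rw [sum_Ici_norm_sq_of_mem_triRow hU, sum_Ici_norm_sq_of_mem_triRow hV] at hnorm
    obtain ⟨s, hs, hsU⟩ := hU.2.1
    obtain ⟨t, ht, htV⟩ := hV.2.1
    rw [← hsU, ← htV, Complex.norm_real, Complex.norm_real, Real.norm_eq_abs, Real.norm_eq_abs,
      sq_abs, sq_abs, sq_eq_sq₀ (by linarith [hs.1]) (by linarith [ht.1])] at hnorm
    rw [← hsU, ← htV, hnorm]
  · rw [hU.2.2 j hj, hV.2.2 j hj]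

theorem row_eq_of_vecMul_star_mem_triRow {U V : UGroup N} {x : Fin N → ℂ}
    (hU : x ᵥ* star U.1 ∈ triRow ε k) (hV : x ᵥ* star V.1 ∈ triRow ε k)
    (h : ∀ j < k, U.1.row j = V.1.row j) : U.1.row k = V.1.row k := by
  obtain ⟨s, hs, hsU⟩ := hU.2.1
  have hne : (x ᵥ* star U.1) k ≠ 0 := by
    rw [← hsU]
    exact_mod_cast (zero_lt_one.trans_le hs.1).ne'
  have hsum : ∑ j, (x ᵥ* star U.1) j • (U.1.row j - V.1.row j) = 0 := by
    have hx : (x ᵥ* star U.1) ᵥ* U.1 = (x ᵥ* star U.1) ᵥ* V.1 := by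
      rw [vecMul_star_vecMul, vecMul_star_eq_of_mem_triRow hU hV h, vecMul_star_vecMul]
    rw [Matrix.vecMul_eq_sum (M := U.1), Matrix.vecMul_eq_sum (M := V.1)] at hx
    simp only [smul_sub, Finset.sum_sub_distrib]
    exact sub_eq_zero.2 hx
  rw [Finset.sum_eq_single k] at hsum
  · exact sub_eq_zero.1 ((smul_eq_zero.1 hsum).resolve_left hne)
  · intro j _ hjk
    rcases hjk.lt_or_gt with hj | hj
    · rw [h j hj, sub_self, smul_zero]
    · rw [hU.2.2 j hj, zero_smul]
  · simp

theorem row_eq_of_forall_vecMul_star_mem_triRow {s : Finset (Fin N)}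
    (hs : IsLowerSet (s : Set (Fin N))) {U V : UGroup N} {M : Fin N → Fin N → ℂ}
    (hU : ∀ i ∈ s, M i ᵥ* star U.1 ∈ triRow ε i)
    (hV : ∀ i ∈ s, M i ᵥ* star V.1 ∈ triRow ε i) (i : Fin N) (hi : i ∈ s) :
    U.1.row i = V.1.row i := by
  induction i using WellFoundedLT.induction with
  | ind i ih =>
    exact row_eq_of_vecMul_star_mem_triRow (hU i hi) (hV i hi) fun j hj => ih j hj (hs hj.le hi)

theorem exists_unitary_row_eq_one (k : Fin N) {v : EuclideanSpace ℂ (Fin N)} (hv : ‖v‖ = 1)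
    (hvk : ∀ j < k, v j = 0) :
    ∃ W : UGroup N, (∀ j < k, W.1.row j = Matrix.row 1 j) ∧ W.1.row k = v.ofLp := by
  let w : Fin N → EuclideanSpace ℂ (Fin N) := fun j =>
    if j < k then EuclideanSpace.single j 1 else v
  have hw : Orthonormal ℂ ((Iic k).domRestrict w) := by
    rw [orthonormal_iff_ite]
    rintro ⟨i, hi⟩ ⟨j, hj⟩
    change inner ℂ (w i) (w j) = _
    simp only [Subtype.mk.injEq, w]
    rcases lt_or_eq_of_le (mem_Iic.1 hi) with hi | rfl <;>
      rcases lt_or_eq_of_le (mem_Iic.1 hj) with hj | rfl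
    · rw [if_pos hi, if_pos hj, EuclideanSpace.inner_single_left]
      simp
    · simp [hi, hi.ne, hvk i hi, EuclideanSpace.inner_single_left]
    · simp [hj, hj.ne', hvk j hj, EuclideanSpace.inner_single_right]
    · simp [hv]
  obtain ⟨W, hW⟩ := exists_unitary_row_eq hw
  refine ⟨W, fun j hj => ?_, ?_⟩
  · rw [hW j hj.le]
    funext l
    simp [w, hj, Matrix.one_apply, eq_comm]
  · rw [hW k (mem_Iic.2 le_rfl)]
    simp [w]

theorem exists_unitary_vecMul_star_mem_triRow (hε : 0 ≤ ε) {y : Fin N → ℂ}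
    (hy : y ∈ sliceSet ε k) :
    ∃ W : UGroup N, (∀ j < k, W.1.row j = Matrix.row 1 j) ∧ y ᵥ* star W.1 ∈ triRow ε k := by
  obtain ⟨hlt, hge⟩ := hy
  set t := √(∑ j ∈ Finset.Ici k, ‖y j‖ ^ 2) with ht
  have ht1 : 1 ≤ t := Real.one_le_sqrt.2 (by simpa using hge.1)
  have htε : t ≤ 1 + ε := (Real.sqrt_le_left (by linarith)).2 hge.2
  have htc : (t : ℂ) ≠ 0 := by exact_mod_cast (zero_lt_one.trans_le ht1).ne'
  let tail : Fin N → ℂ := fun j => if j < k then 0 else y j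
  let head : Fin N → ℂ := fun j => if j < k then y j else 0
  have htail : ‖WithLp.toLp 2 tail‖ = t := by
    rw [EuclideanSpace.norm_eq, ht, ← Finset.sum_subset (Finset.subset_univ (Finset.Ici k))]
    · refine congrArg Real.sqrt (Finset.sum_congr rfl fun j hj => ?_)
      simp [tail, (Finset.mem_Ici.1 hj).not_gt]
    · intro j _ hj
      simp [tail, not_le.1 (Finset.mem_Ici.not.1 hj)]
  obtain ⟨W, hWlt, hWk⟩ := exists_unitary_row_eq_one k
    (v := (t : ℂ)⁻¹ • WithLp.toLp 2 tail)
    (by rw [norm_smul, htail, norm_inv, Complex.norm_real, Real.norm_of_nonneg (by linarith),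
      inv_mul_cancel₀ (by linarith)]) (fun j hj => by simp [tail, hj])
  have hhead : head ᵥ* W.1 = head := by
    rw [vecMul_congr (B := 1), Matrix.vecMul_one]
    intro j
    by_cases hj : j < k
    · exact .inr (hWlt j hj)
    · exact .inl (if_neg hj)
  have hyz : y = (head + Pi.single k (t : ℂ)) ᵥ* W.1 := by
    rw [Matrix.add_vecMul, hhead, Matrix.single_vecMul, hWk]
    funext j
    by_cases hj : j < k <;> simp [head, tail, hj, htc]
  refine ⟨W, hWlt, ?_⟩
  rw [hyz, vecMul_vecMul_star]
  refine ⟨fun j hj => ?_, ⟨t, ⟨ht1, htε⟩, ?_⟩, fun j hj => ?_⟩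
  · simpa [head, hj, hj.ne] using hlt j hj
  · simp [head]
  · simp [head, hj.not_gt, hj.ne']

end TriangularRows

section TriangularSets

variable {N : ℕ} {ε : ℝ}

instance isProbabilityMeasure_haarU : IsProbabilityMeasure (haarU N) := ⟨haarMeasure_self⟩

/-- The matrices, given by their rows, whose rows with index in `s` are those of a product `T U`
with `U ∈ C` and `T` lower triangular with rows in `triRow ε`. -/
def triSet (ε : ℝ) (s : Finset (Fin N)) (C : Set (UGroup N)) : Set (Fin N → Fin N → ℂ) :=
  {M | ∃ U ∈ C, ∀ i ∈ s, M i ᵥ* star U.1 ∈ triRow ε i}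

theorem isClosed_triSet (ε : ℝ) (s : Finset (Fin N)) {C : Set (UGroup N)} (hC : IsClosed C) :
    IsClosed (triSet ε s C) := by
  have hset : triSet ε s C = Prod.fst '' (Prod.snd ⁻¹' C ∩
      ⋂ i ∈ s, (fun p : (Fin N → Fin N → ℂ) × UGroup N => p.1 i ᵥ* star p.2.1) ⁻¹' triRow ε i) := by
    ext M
    simp [triSet]
  rw [hset]
  refine isClosedMap_fst_of_compactSpace _ ((hC.preimage continuous_snd).inter
    (isClosed_biInter fun i _ => (isClosed_triRow ε i).preimage ?_))
  exact ((continuous_apply i).comp continuous_fst).matrix_vecMul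
    (continuous_subtype_val.comp continuous_snd).star

theorem mem_triSet_Iic_iff (hε : 0 ≤ ε) {k : Fin N} {M : Fin N → Fin N → ℂ} {U : UGroup N}
    (hU : ∀ i ∈ Finset.Iio k, M i ᵥ* star U.1 ∈ triRow ε i) :
    M ∈ triSet ε (Finset.Iic k) univ ↔ M k ᵥ* star U.1 ∈ sliceSet ε k := by
  constructor
  · rintro ⟨V, -, hV⟩
    have hrow := row_eq_of_forall_vecMul_star_mem_triRow (by simpa using isLowerSet_Iio k)
      (fun i hi => hV i (Finset.Iio_subset_Iic_self hi)) hU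
    exact (vecMul_star_mem_sliceSet_congr (fun j hj => hrow j (Finset.mem_Iio.2 hj)) _).1
      (triRow_subset_sliceSet (hV k (Finset.mem_Iic.2 le_rfl)))
  · intro h
    obtain ⟨W, hWrow, hW⟩ := exists_unitary_vecMul_star_mem_triRow hε h
    refine ⟨W * U, mem_univ _, fun i hi => ?_⟩
    rw [vecMul_star_mul]
    rcases (Finset.mem_Iic.1 hi).lt_or_eq with hik | rfl
    · have hi' := hU i (Finset.mem_Iio.2 hik)
      have hfix : (M i ᵥ* star U.1) ᵥ* W.1 = M i ᵥ* star U.1 := by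
        rw [vecMul_congr (B := 1), Matrix.vecMul_one]
        intro j
        rcases lt_or_ge j k with hj | hj
        · exact .inr (hWrow j hj)
        · exact .inl (hi'.2.2 j (hik.trans_le hj))
      rwa [← hfix, vecMul_vecMul_star]
    · exact hW

theorem lintegral_update_indicator_triSet (hε : 0 ≤ ε) (c : ℝ≥0∞) (k : Fin N)
    (M : Fin N → Fin N → ℂ) :
    ∫⁻ x, (triSet ε (Finset.Iic k) univ).indicator (fun _ => c) (Function.update M k x) =
      (triSet ε (Finset.Iio k) univ).indicator (fun _ => c * volume (sliceSet ε k)) M := by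
  have hrow (x : Fin N → ℂ) (i) (hi : i ∈ Finset.Iio k) : Function.update M k x i = M i :=
    Function.update_of_ne (Finset.mem_Iio.1 hi).ne x M
  by_cases hM : M ∈ triSet ε (Finset.Iio k) univ
  · obtain ⟨U, -, hU⟩ := id hM
    have hpre : Function.update M k ⁻¹' triSet ε (Finset.Iic k) univ =
        (· ᵥ* star U.1) ⁻¹' sliceSet ε k := by
      ext x
      rw [mem_preimage, mem_preimage, mem_triSet_Iic_iff hε fun i hi => by
        rw [hrow x i hi]; exact hU i hi, Function.update_self]
    have hpres : MeasurePreserving (fun x : Fin N → ℂ => x ᵥ* star U.1) :=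
      measurePreserving_vecMul U⁻¹
    rw [indicator_of_mem hM, lintegral_indicator_const_comp (measurable_update M)
      (isClosed_triSet ε _ isClosed_univ).measurableSet, hpre,
      hpres.measure_preimage (isClosed_sliceSet ε k).measurableSet.nullMeasurableSet]
  · have hnot (x : Fin N → ℂ) : Function.update M k x ∉ triSet ε (Finset.Iic k) univ := by
      rintro ⟨U, -, hU⟩
      exact hM ⟨U, mem_univ _, fun i hi => hrow x i hi ▸ hU i (Finset.Iio_subset_Iic_self hi)⟩
    simp only [indicator_of_notMem hM, indicator_of_notMem (hnot _), lintegral_zero]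

theorem lmarginal_indicator_triSet (hε : 0 ≤ ε) (s : Finset (Fin N)) :
    IsLowerSet (s : Set (Fin N)) → ∀ c : ℝ≥0∞,
      (∫⋯∫⁻_s, (triSet ε s univ).indicator (fun _ => c) ∂fun _ => volume) =
        fun _ => c * ∏ k ∈ s, volume (sliceSet ε k) := by
  induction s using Finset.induction_on_max with
  | empty =>
    intro _ c
    have huniv : triSet (N := N) ε ∅ univ = univ := eq_univ_of_forall fun M => ⟨1, by simp⟩
    simp [huniv]
  | insert k s hlt ih =>
    intro hs c
    have hks : k ∉ s := fun hk => (hlt k hk).false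
    obtain rfl : s = Finset.Iio k := by
      refine Finset.Subset.antisymm (fun i hi => Finset.mem_Iio.2 (hlt i hi)) fun i hi => ?_
      have hik := Finset.mem_Iio.1 hi
      exact Finset.mem_of_mem_insert_of_ne (hs hik.le (by simp)) hik.ne
    rw [lmarginal_insert' _ (measurable_const.indicator
      (isClosed_triSet ε _ isClosed_univ).measurableSet) hks, Finset.Iio_insert]
    simp only [lintegral_update_indicator_triSet hε]
    rw [ih (by simpa using isLowerSet_Iio k), ← Finset.Iio_insert, Finset.prod_insert hks]
    simp only [mul_assoc]

theorem volume_triSet_univ (hε : 0 ≤ ε) :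
    volume (triSet (N := N) ε Finset.univ univ) = ∏ k : Fin N, volume (sliceSet ε k) := by
  have h := congrFun (lmarginal_indicator_triSet (N := N) hε Finset.univ
    (by simpa using isLowerSet_univ) 1) 0
  rw [lmarginal_univ, lintegral_indicator_const
    (isClosed_triSet ε _ isClosed_univ).measurableSet] at h
  simpa only [one_mul, ← volume_pi] using h

theorem volume_sliceSet (hε : 0 ≤ ε) (k : Fin N) :
    volume (sliceSet ε k) = volume (Metric.closedBall (0 : ℂ) ε) ^ (k : ℕ) * ENNReal.ofReal
      (((1 + ε) ^ (2 * (N - k)) - 1) * (Real.pi ^ (N - k : ℕ) / (N - k : ℕ).factorial)) := by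
  have hset : sliceSet ε k = MeasurableEquiv.piEquivPiSubtypeProd (fun _ : Fin N => ℂ) (· < k) ⁻¹'
      ((univ.pi fun _ : {j // j < k} => Metric.closedBall (0 : ℂ) ε) ×ˢ
        {x : {j // ¬ j < k} → ℂ | ∑ i, ‖x i‖ ^ 2 ∈ Icc (1 ^ 2) ((1 + ε) ^ 2)}) := by
    ext y
    have hsum : ∑ j ∈ Finset.Ici k, ‖y j‖ ^ 2 = ∑ i : {j // ¬ j < k}, ‖y i‖ ^ 2 :=
      Finset.sum_subtype _ (by simp) _
    simp [sliceSet, hsum, MeasurableEquiv.piEquivPiSubtypeProd, Equiv.piEquivPiSubtypeProd]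
  have hne : Nonempty {j // ¬ j < k} := ⟨⟨k, lt_irrefl k⟩⟩
  have hcard : Fintype.card {j // j < k} = k := by
    rw [Fintype.card_subtype, show Finset.univ.filter (· < k) = Finset.Iio k by ext; simp,
      Fin.card_Iio]
  have hcard' : Fintype.card {j // ¬ j < k} = N - k := by
    rw [Fintype.card_subtype_compl, hcard, Fintype.card_fin]
  rw [hset, (volume_preserving_piEquivPiSubtypeProd _ _).measure_preimage_equiv,
    Measure.volume_eq_prod, prod_prod, volume_pi_pi, Finset.prod_const, Finset.card_univ, hcard,
    volume_sum_norm_sq_mem_Icc _ one_pos (by linarith), hcard', one_pow]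

theorem vecMul_mem_triSet_iff {C : Set (UGroup N)} {M : Fin N → Fin N → ℂ} {V : UGroup N}
    (hV : ∀ i ∈ Finset.univ, M i ᵥ* star V.1 ∈ triRow ε i) (U : UGroup N) :
    (fun i => M i ᵥ* U.1) ∈ triSet ε Finset.univ C ↔ V * U ∈ C := by
  constructor
  · rintro ⟨W, hW, h⟩
    have hrow := row_eq_of_forall_vecMul_star_mem_triRow (U := W * U⁻¹) (V := V)
      (by simpa using isLowerSet_univ) (fun i hi => ?_) hV
    · rwa [← show W * U⁻¹ = V from Subtype.ext (funext fun i => hrow i (Finset.mem_univ i)),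
        inv_mul_cancel_right]
    · rw [← vecMul_vecMul_star (M i) U, ← vecMul_star_mul]
      simpa using h i hi
  · intro h
    refine ⟨V * U, h, fun i hi => ?_⟩
    rw [vecMul_star_mul, vecMul_vecMul_star]
    exact hV i hi

theorem volume_triSet (ε : ℝ) {C : Set (UGroup N)} (hC : IsClosed C) :
    volume (triSet ε Finset.univ C) = haarU N C * volume (triSet (N := N) ε Finset.univ univ) := by
  set S : Set ((Fin N → Fin N → ℂ) × UGroup N) :=
    {p | (fun i => p.1 i ᵥ* p.2.1) ∈ triSet ε Finset.univ C}
  have hclosed := isClosed_triSet ε Finset.univ hC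
  have hS : MeasurableSet S :=
    (hclosed.preimage (continuous_pi fun i => ((continuous_apply i).comp
      continuous_fst).matrix_vecMul (continuous_subtype_val.comp continuous_snd))).measurableSet
  have hslice (U : UGroup N) : volume ((·, U) ⁻¹' S) = volume (triSet ε Finset.univ C) :=
    (volume_preserving_pi fun _ => measurePreserving_vecMul U).measure_preimage
      hclosed.measurableSet.nullMeasurableSet
  have hslice' (M : Fin N → Fin N → ℂ) : haarU N (Prod.mk M ⁻¹' S) =
      (triSet ε Finset.univ univ).indicator (fun _ => haarU N C) M := by
    by_cases hM : M ∈ triSet ε Finset.univ univ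
    · obtain ⟨V, -, hV⟩ := id hM
      rw [indicator_of_mem hM, ← measure_preimage_mul (haarU N) V C]
      exact congrArg _ (Set.ext fun U => vecMul_mem_triSet_iff hV U)
    · rw [indicator_of_notMem hM, show Prod.mk M ⁻¹' S = ∅ from ?_, measure_empty]
      refine eq_empty_of_forall_notMem fun U ⟨W, _, h⟩ => hM ⟨W * U⁻¹, mem_univ _, fun i hi => ?_⟩
      rw [← vecMul_vecMul_star (M i) U, ← vecMul_star_mul]
      simpa using h i hi
  calc volume (triSet ε Finset.univ C) = (volume.prod (haarU N)) S := by
        simp only [prod_apply_symm hS, hslice, lintegral_const, measure_univ, mul_one]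
    _ = haarU N C * volume (triSet ε Finset.univ univ) := by
        simp only [prod_apply hS, hslice']
        exact lintegral_indicator_const (isClosed_triSet ε _ isClosed_univ).measurableSet _

end TriangularSets

section LocalChart

theorem tendsto_addHaar_image_div {E : Type*} [NormedAddCommGroup E] [NormedSpace ℝ E]
    [FiniteDimensional ℝ E] [MeasurableSpace E] [BorelSpace E] (μ : Measure E) [μ.IsAddHaarMeasure]
    {f : E → E} {f' : E →L[ℝ] E} {x : E} (hf : HasStrictFDerivAt f f' x) {ι : Type*}
    {l : Filter ι} {s : ι → Set E} (hs : Tendsto s l (𝓝 x).smallSets)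
    (hs₀ : ∀ᶠ i in l, μ (s i) ≠ 0) :
    Tendsto (fun i => μ (f '' s i) / μ (s i)) l (𝓝 (ENNReal.ofReal |f'.det|)) := by
  have hfin : ∀ᶠ i in l, μ (s i) ≠ ∞ := by
    obtain ⟨t, ht, hμt⟩ := μ.finiteAt_nhds x
    filter_upwards [tendsto_smallSets_iff.1 hs t ht] with i hi
    exact ((measure_mono hi).trans_lt hμt).ne
  have approximates {δ : ℝ≥0} (hδ : 0 < δ) : ∀ᶠ i in l, ApproximatesLinearOn f f' (s i) δ := by
    obtain ⟨t, ht, happ⟩ := hf.approximates_deriv_on_nhds (.inr hδ)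
    filter_upwards [tendsto_smallSets_iff.1 hs t ht] with i hi using happ.mono_set hi
  refine tendsto_order.2 ⟨fun a ha => ?_, fun a ha => ?_⟩ <;>
    obtain ⟨m, hm, hm'⟩ := ENNReal.lt_iff_exists_nnreal_btwn.1 ha
  · obtain ⟨δ, hδ, hδ₀⟩ := ((mul_le_addHaar_image_of_lt_det μ f' hm').and
      self_mem_nhdsWithin).exists
    filter_upwards [hs₀, hfin, approximates hδ₀] with i h₀ h happ
    exact hm.trans_le ((ENNReal.le_div_iff_mul_le (.inl h₀) (.inl h)).2 (hδ _ _ happ))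
  · obtain ⟨δ, hδ, hδ₀⟩ := ((addHaar_image_le_mul_of_det_lt μ f' hm).and
      self_mem_nhdsWithin).exists
    filter_upwards [hs₀, hfin, approximates hδ₀] with i h₀ h happ
    exact ((ENNReal.div_le_iff h₀ h).2 (hδ _ _ happ)).trans_lt hm'

variable {N : ℕ}

/-- The lower triangular matrix `X` with real diagonal encoded by a complex matrix: its entries
below the diagonal are negated, and its diagonal entries are the real parts. -/
def lowerPart : Matrix (Fin N) (Fin N) ℂ →ₗ[ℝ] Matrix (Fin N) (Fin N) ℂ where
  toFun M := .of fun j k => if k < j then -M j k else if j = k then ((M j k).re : ℂ) else 0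
  map_add' M M' := by
    ext j k
    simp only [Matrix.of_apply, Matrix.add_apply]
    split_ifs <;> simp [add_comm]
  map_smul' c M := by
    ext j k
    simp only [Matrix.of_apply, Matrix.smul_apply, RingHom.id_apply]
    split_ifs <;> simp

/-- The coordinates of the Hermitian matrix `H` encoded by a complex matrix: the entries of `iH` on
and above the diagonal are the imaginary parts of the diagonal and the entries above it. -/
def hermCoords (M : Matrix (Fin N) (Fin N) ℂ) (p : Fin N × Fin N) : ℝ :=
  if p.1 = p.2 then (M p.1 p.2).im
  else if p.1 < p.2 then √2 * (M p.1 p.2).im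
  else -(√2 * (M p.2 p.1).re)

/-- The sum `X + iH` of the two matrices encoded by a complex matrix through `lowerPart` and
`hermCoords`. The sign in `lowerPart` makes it an involution. -/
def chartDeriv : Matrix (Fin N) (Fin N) ℂ →ₗ[ℝ] Matrix (Fin N) (Fin N) ℂ where
  toFun M := .of fun j k => if k < j then -(M j k + star (M k j)) else M j k
  map_add' M M' := by
    ext j k
    simp only [Matrix.of_apply, Matrix.add_apply]
    split_ifs
    · rw [star_add]; ring
    · rfl
  map_smul' c M := by
    ext j k
    simp only [Matrix.of_apply, Matrix.smul_apply, RingHom.id_apply]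
    split_ifs
    · rw [star_smul, star_trivial, ← smul_add, smul_neg]
    · rfl

theorem abs_det_chartDeriv : |LinearMap.det (chartDeriv (N := N))| = 1 := by
  have hinv : chartDeriv (N := N) ∘ₗ chartDeriv = LinearMap.id := by
    ext M j k
    simp only [LinearMap.comp_apply, LinearMap.id_apply, chartDeriv, LinearMap.coe_mk,
      AddHom.coe_mk, Matrix.of_apply]
    split_ifs with h h'
    · exact absurd h' h.not_gt
    · ring
    · rfl
  have hsq := congrArg LinearMap.det hinv
  rw [LinearMap.det_comp, LinearMap.det_id] at hsq
  exact abs_eq (zero_le_one' ℝ) |>.2 (mul_self_eq_one_iff.1 hsq)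

theorem I_smul_hermOfCoords_hermCoords (M : Matrix (Fin N) (Fin N) ℂ) :
    Complex.I • (hermOfCoords (hermCoords M)).1 = chartDeriv M - lowerPart M := by
  ext j k
  simp only [lowerPart, chartDeriv, hermOfCoords, hermCoords, Matrix.smul_apply, Matrix.sub_apply,
    LinearMap.coe_mk, AddHom.coe_mk, Matrix.of_apply, smul_eq_mul]
  rcases lt_trichotomy j k with h | rfl | h
  · simp only [h.ne, h.ne', h, h.not_gt, if_false, if_true]
    apply Complex.ext <;> simp [field]
  · apply Complex.ext <;> simp
  · simp only [h.ne, h.ne', h, h.not_gt, if_false, if_true]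
    apply Complex.ext <;> simp [field]

/-- The map `(X, H) ↦ (1 + X) e^{iH}`, with `(X, H)` encoded by one complex matrix. -/
def lowerExpChart (M : Matrix (Fin N) (Fin N) ℂ) : Matrix (Fin N) (Fin N) ℂ :=
  (1 + lowerPart M) * (expI (hermOfCoords (hermCoords M))).1

theorem hasStrictFDerivAt_lowerExpChart : HasStrictFDerivAt (𝕜 := ℝ) (lowerExpChart (N := N))
    (LinearMap.toContinuousLinearMap chartDeriv) 0 := by
  set L := LinearMap.toContinuousLinearMap (lowerPart (N := N))
  set D := LinearMap.toContinuousLinearMap (chartDeriv (N := N))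
  have hchart : lowerExpChart (N := N) = fun M => (1 + L M) * NormedSpace.exp ((D - L) M) := by
    ext1 M
    exact congrArg (fun Y => (1 + lowerPart M) * NormedSpace.exp Y)
      (I_smul_hermOfCoords_hermCoords M)
  have hexp : HasStrictFDerivAt (𝕜 := ℝ) (NormedSpace.exp : Matrix (Fin N) (Fin N) ℂ → _)
      (1 : Matrix (Fin N) (Fin N) ℂ →L[ℝ] Matrix (Fin N) (Fin N) ℂ) ((D - L) 0) := by
    rw [map_zero]
    exact hasStrictFDerivAt_exp_zero
  rw [hchart]
  refine ((L.hasStrictFDerivAt.const_add 1).mul'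
    (hexp.comp 0 (D - L).hasStrictFDerivAt)).congr_fderiv ?_
  ext1 M
  simp only [map_zero, add_zero, NormedSpace.exp_zero, one_smul]
  change D M - L M + L M * 1 = D M
  rw [mul_one, sub_add_cancel]

/-- The Hermitian matrices with coordinates in `[-t, t]`. -/
def hermBox (N : ℕ) (t : ℝ) : Set (Herm N) := hermOfCoords '' Metric.closedBall 0 t

/-- The matrices encoding the pairs `(X, H)` such that the rows of `1 + X` lie in `triRow t` and
`H` lies in `hermBox N t`. -/
def chartBox (N : ℕ) (t : ℝ) : Set (Fin N → Fin N → ℂ) :=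
  {M | hermCoords M ∈ Metric.closedBall 0 t ∧ ∀ j, (1 + lowerPart M) j ∈ triRow t j}

theorem exists_lowerPart_hermCoords_eq {X : Matrix (Fin N) (Fin N) ℂ}
    (hd : ∀ j, (X j j).im = 0) (hu : ∀ j k, j < k → X j k = 0)
    (x : Fin N × Fin N → ℝ) : ∃ M, lowerPart M = X ∧ hermCoords M = x := by
  have hsqrt : √2 ≠ 0 := (Real.sqrt_pos.2 two_pos).ne'
  refine ⟨.of fun j k => if k < j then -X j k else if j = k then X j j + x (j, k) * Complex.I
    else ⟨-x (k, j) / √2, x (j, k) / √2⟩, ?_, ?_⟩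
  · ext j k
    rcases lt_trichotomy j k with h | rfl | h
    · simp [lowerPart, h.ne, h.not_gt, hu j k h]
    · apply Complex.ext <;> simp [lowerPart, hd]
    · simp [lowerPart, h]
  · ext ⟨j, k⟩
    rcases lt_trichotomy j k with h | rfl | h
    · simp [hermCoords, h.ne, h, h.not_gt, field]
    · simp [hermCoords, hd]
    · simp [hermCoords, h.ne, h.ne', h.not_gt, field]

theorem image_lowerExpChart_chartBox (N : ℕ) (t : ℝ) :
    lowerExpChart '' chartBox N t = triSet t Finset.univ (expI '' hermBox N t) := by
  ext M'
  constructor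
  · rintro ⟨M, ⟨hx, hT⟩, rfl⟩
    refine ⟨_, mem_image_of_mem _ (mem_image_of_mem _ hx), fun j _ => ?_⟩
    rw [lowerExpChart, Matrix.mul_apply_eq_vecMul, vecMul_vecMul_star]
    exact hT j
  · rintro ⟨_, ⟨_, ⟨x, hx, rfl⟩, rfl⟩, hT⟩
    set U := expI (hermOfCoords x)
    set T : Matrix (Fin N) (Fin N) ℂ := .of fun j => M' j ᵥ* star U.1
    have hrow (j : Fin N) : T j ∈ triRow t j := hT j (Finset.mem_univ j)
    obtain ⟨M, hX, rfl⟩ := exists_lowerPart_hermCoords_eq (X := T - 1) (fun j => by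
        obtain ⟨s, -, hs⟩ := (hrow j).2.1
        simp [← hs]) (fun j k h => by
        rw [Matrix.sub_apply, Matrix.one_apply_ne h.ne, (hrow j).2.2 k h, sub_zero]) x
    have hT' : 1 + lowerPart M = T := by rw [hX, add_sub_cancel]
    refine ⟨M, ⟨hx, fun j => hT' ▸ hrow j⟩, ?_⟩
    funext j
    rw [lowerExpChart, hT', Matrix.mul_apply_eq_vecMul]
    exact vecMul_star_vecMul (M' j) U

end LocalChart

section TestBox

variable {N : ℕ} {t : ℝ}

theorem one_add_lowerPart_mem_triRow_iff {M : Matrix (Fin N) (Fin N) ℂ} {j : Fin N} :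
    (1 + lowerPart M) j ∈ triRow t j ↔ (∀ k < j, ‖M j k‖ ≤ t) ∧ (M j j).re ∈ Icc 0 t := by
  have hlt (k : Fin N) (hk : k < j) : (1 + lowerPart M) j k = -M j k := by
    simp [lowerPart, hk, hk.ne']
  have hgt (k : Fin N) (hk : j < k) : (1 + lowerPart M) j k = 0 := by
    simp [lowerPart, hk.ne, hk.not_gt]
  have heq : (1 + lowerPart M) j j = ((1 + (M j j).re : ℝ) : ℂ) := by simp [lowerPart]
  rw [triRow, mem_ofPred_eq, heq, Complex.ofReal_injective.mem_set_image,
    and_iff_left hgt, ← add_zero (1 : ℝ), add_assoc]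
  refine and_congr (forall₂_congr fun k hk => by rw [hlt k hk, norm_neg]) ?_
  simp [mem_Icc]

theorem hermCoords_mem_closedBall_iff (ht : 0 ≤ t) {M : Matrix (Fin N) (Fin N) ℂ} :
    hermCoords M ∈ Metric.closedBall 0 t ↔ (∀ j, (M j j).im ∈ Icc (-t) t) ∧
      ∀ j k, j < k → M j k ∈ Icc (-(t / √2)) (t / √2) ×ℂ Icc (-(t / √2)) (t / √2) := by
  have hsqrt : 0 < √2 := Real.sqrt_pos.2 two_pos
  have habs (a : ℝ) : a ∈ Icc (-(t / √2)) (t / √2) ↔ |√2 * a| ≤ t := by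
    rw [mem_Icc, ← abs_le, le_div_iff₀' hsqrt, abs_mul, abs_of_pos hsqrt]
  simp only [mem_closedBall_zero_iff, pi_norm_le_iff_of_nonneg ht, Prod.forall, Real.norm_eq_abs,
    Complex.mem_reProdIm, habs, mem_Icc, ← abs_le]
  constructor
  · refine fun h => ⟨fun j => by simpa [hermCoords] using h j j, fun j k hjk => ⟨?_, ?_⟩⟩
    · simpa [hermCoords, hjk.ne', hjk.not_gt] using h k j
    · simpa [hermCoords, hjk.ne, hjk] using h j k
  · rintro ⟨hd, hu⟩ j k
    rcases lt_trichotomy j k with h | rfl | h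
    · simpa [hermCoords, h.ne, h] using (hu j k h).2
    · simpa [hermCoords] using hd j
    · simpa [hermCoords, h.ne', h.not_gt] using (hu k j h).1

/-- The possible entries at `(j, k)` of the elements of `chartBox N t`. -/
def chartBoxEntry (t : ℝ) (j k : Fin N) : Set ℂ :=
  if k < j then Metric.closedBall 0 t
  else if j = k then Icc 0 t ×ℂ Icc (-t) t
  else Icc (-(t / √2)) (t / √2) ×ℂ Icc (-(t / √2)) (t / √2)

theorem chartBox_eq_pi (ht : 0 ≤ t) :
    chartBox N t = univ.pi fun j => univ.pi fun k => chartBoxEntry t j k := by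
  ext M
  refine (and_congr (hermCoords_mem_closedBall_iff ht)
    (forall_congr' fun j => one_add_lowerPart_mem_triRow_iff)).trans ?_
  simp only [mem_univ_pi]
  constructor
  · rintro ⟨⟨him, hu⟩, hrow⟩ j k
    rcases lt_trichotomy j k with h | rfl | h
    · simpa [chartBoxEntry, h.ne, h.not_gt] using hu j k h
    · simpa [chartBoxEntry, Complex.mem_reProdIm] using ⟨(hrow j).2, him j⟩
    · simpa [chartBoxEntry, h] using (hrow j).1 k h
  · intro h
    have hd (j : Fin N) : M j j ∈ Icc 0 t ×ℂ Icc (-t) t := by simpa [chartBoxEntry] using h j j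
    refine ⟨⟨fun j => (hd j).2, fun j k hjk => ?_⟩, fun j => ⟨fun k hk => ?_, (hd j).1⟩⟩
    · simpa [chartBoxEntry, hjk.ne, hjk.not_gt] using h j k
    · simpa [chartBoxEntry, hk] using h j k

theorem norm_le_of_mem_reProdIm_Icc {z : ℂ} {a b : ℝ} (hz : z ∈ Icc (-a) a ×ℂ Icc (-b) b) :
    ‖z‖ ≤ a + b :=
  (Complex.norm_le_abs_re_add_abs_im z).trans (add_le_add (abs_le.2 hz.1) (abs_le.2 hz.2))

theorem chartBoxEntry_subset_closedBall (ht : 0 ≤ t) (j k : Fin N) :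
    chartBoxEntry t j k ⊆ Metric.closedBall 0 (2 * t) := by
  have hsqrt : t / √2 ≤ t := div_le_self ht (Real.one_le_sqrt.2 one_le_two)
  rw [chartBoxEntry]
  split_ifs
  · exact Metric.closedBall_subset_closedBall (by linarith)
  all_goals
    refine fun z hz => mem_closedBall_zero_iff.2
      ((norm_le_of_mem_reProdIm_Icc (a := t) (b := t) ?_).trans_eq (two_mul t).symm)
    exact ⟨Icc_subset_Icc (by linarith) (by linarith) hz.1,
      Icc_subset_Icc (by linarith) (by linarith) hz.2⟩

theorem tendsto_chartBox_smallSets :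
    Tendsto (chartBox N) (𝓝[>] 0) (𝓝 (0 : Fin N → Fin N → ℂ)).smallSets := by
  refine tendsto_smallSets_iff.2 fun s hs => ?_
  obtain ⟨δ, hδ, hball⟩ := Metric.nhds_basis_closedBall.mem_iff.1 hs
  filter_upwards [Ioc_mem_nhdsGT (half_pos hδ)] with t ⟨ht, htδ⟩
  refine Subset.trans ?_
    ((Metric.closedBall_subset_closedBall (show 2 * t ≤ δ by linarith)).trans hball)
  have hpos : 0 ≤ 2 * t := by positivity
  rw [chartBox_eq_pi ht.le]
  refine fun M hM => (mem_closedBall_zero_iff (r := 2 * t)).2 <|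
    (pi_norm_le_iff_of_nonneg hpos).2 fun j =>
      (pi_norm_le_iff_of_nonneg hpos).2 fun k => mem_closedBall_zero_iff.1 ?_
  exact chartBoxEntry_subset_closedBall ht.le j k (hM j trivial k trivial)

theorem volume_reProdIm (s u : Set ℝ) : volume (s ×ℂ u) = volume s * volume u := by
  rw [← prod_prod, ← Measure.volume_eq_prod,
    ← Complex.volume_preserving_equiv_real_prod.measure_preimage_equiv]
  rfl

theorem volume_chartBoxEntry (ht : 0 ≤ t) (j k : Fin N) : volume (chartBoxEntry t j k) =
    if k < j then volume (Metric.closedBall (0 : ℂ) t) else ENNReal.ofReal (2 * t ^ 2) := by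
  rw [chartBoxEntry]
  split_ifs
  · rfl
  · rw [volume_reProdIm, Real.volume_Icc, Real.volume_Icc, ← ENNReal.ofReal_mul (by linarith)]
    ring_nf
  · rw [volume_reProdIm, Real.volume_Icc, ← ENNReal.ofReal_mul (by ring_nf; positivity)]
    congr 1
    have hsqrt : √2 ^ 2 = 2 := Real.sq_sqrt two_pos.le
    field_simp
    rw [hsqrt]
    ring

theorem volume_chartBox (ht : 0 ≤ t) : volume (chartBox N t) = ∏ j : Fin N,
    volume (Metric.closedBall (0 : ℂ) t) ^ (j : ℕ) * ENNReal.ofReal (2 * t ^ 2) ^ (N - j : ℕ) := by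
  rw [chartBox_eq_pi ht, volume_pi_pi]
  refine Finset.prod_congr rfl fun j _ => ?_
  have hIio : Finset.univ.filter (· < j) = Finset.Iio j := by ext; simp
  have hIci : Finset.univ.filter (fun k => ¬ k < j) = Finset.Ici j := by ext; simp
  simp only [volume_pi_pi, volume_chartBoxEntry ht, Finset.prod_ite, Finset.prod_const, hIio, hIci,
    Fin.card_Iio, Fin.card_Ici]

theorem hermBox_subset_closedBall (N : ℕ) :
    ∃ C : ℝ, ∀ t, hermBox N t ⊆ Metric.closedBall 0 (C * t) := by
  obtain ⟨C, hC⟩ : ∃ C, LipschitzWith C (WithLp.toLp 2 : (Fin N × Fin N → ℝ) → _) :=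
    ⟨_, PiLp.lipschitzWith_toLp 2 _⟩
  refine ⟨C, fun t => image_subset_iff.2 fun x hx => ?_⟩
  rw [mem_preimage, mem_closedBall_zero_iff, norm_hermOfCoords]
  exact (hC.norm_le_mul rfl x).trans
    (mul_le_mul_of_nonneg_left (mem_closedBall_zero_iff.1 hx) (NNReal.coe_nonneg _))

theorem lebesgueH_hermBox (ht : 0 ≤ t) : lebesgueH N (hermBox N t) =
    ENNReal.ofReal ((2 * t) ^ N ^ 2) := by
  have hclosed : IsClosed (hermBox N t) :=
    ((isCompact_closedBall 0 t).image (continuous_hermOfCoords N)).isClosed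
  have hinj : Function.Injective (hermOfCoords (N := N)) := fun x y h => by
    have hnorm := norm_hermOfCoords (x - y)
    rw [hermOfCoords_sub, h, sub_self, norm_zero, eq_comm, norm_eq_zero] at hnorm
    exact sub_eq_zero.1 (congrArg WithLp.ofLp hnorm)
  rw [lebesgueH, map_apply (continuous_hermOfCoords N).measurable hclosed.measurableSet, hermBox,
    preimage_image_eq _ hinj, Real.volume_pi_closedBall 0 ht, Fintype.card_prod, Fintype.card_fin,
    sq]

end TestBox

section HaarDensity

variable {N : ℕ} {t : ℝ}

theorem constC_eq_prod (N : ℕ) :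
    constC N = ∏ m ∈ Finset.range N, (m.factorial : ℝ) / (2 * Real.pi) ^ (m + 1) := by
  have hexp : N * (N + 1) / 2 = ∑ m ∈ Finset.range N, (m + 1) := by
    have hgauss := Finset.sum_range_id (N + 1)
    rw [Finset.sum_range_succ', add_zero, add_tsub_cancel_right] at hgauss
    rw [hgauss, mul_comm]
  have hfac : ∏ j ∈ Finset.Icc 1 (N - 1), (j.factorial : ℝ) =
      ∏ j ∈ Finset.range N, (j.factorial : ℝ) := by
    refine Finset.prod_subset (fun j hj => ?_) fun j hj hj' => ?_
    · simp only [Finset.mem_Icc, Finset.mem_range] at hj ⊢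
      lia
    · simp only [Finset.mem_Icc, Finset.mem_range] at hj hj'
      rw [show j = 0 by lia, Nat.factorial_zero, Nat.cast_one]
  rw [constC, hfac, hexp, ← Finset.prod_pow_eq_pow_sum, Finset.prod_div_distrib]

theorem prod_fin_sub_eq_prod_range {M : Type*} [CommMonoid M] (f : ℕ → M) (N : ℕ) :
    ∏ j : Fin N, f (N - j) = ∏ m ∈ Finset.range N, f (m + 1) := by
  rw [Fin.prod_univ_eq_prod_range (fun j => f (N - j)) N, ← Finset.prod_range_reflect]
  refine Finset.prod_congr rfl fun j hj => ?_
  rw [show N - (N - 1 - j) = j + 1 by have := Finset.mem_range.1 hj; lia]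

/-- The contribution to `volume (chartBox N t)`, relative to the volume of the corresponding slice
and to `lebesgueH N (hermBox N t)`, of the row with `m` zeros above the diagonal. -/
def rowRatio (m : ℕ) (t : ℝ) : ℝ :=
  (m + 1).factorial * (2 * t) / (((1 + t) ^ (2 * (m + 1)) - 1) * (2 * Real.pi) ^ (m + 1))

theorem one_add_pow_sub_one_pos (ht : 0 < t) (m : ℕ) : 0 < (1 + t) ^ (2 * (m + 1)) - 1 :=
  sub_pos.2 (one_lt_pow₀ (by linarith) (by lia))

theorem rowRatio_pos (ht : 0 < t) (m : ℕ) : 0 < rowRatio m t := by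
  have := one_add_pow_sub_one_pos ht m
  unfold rowRatio
  positivity

theorem tendsto_rowRatio (m : ℕ) :
    Tendsto (rowRatio m) (𝓝[>] 0) (𝓝 (m.factorial / (2 * Real.pi) ^ (m + 1))) := by
  have hslope : Tendsto (fun t : ℝ => t⁻¹ * ((1 + t) ^ (2 * (m + 1)) - 1)) (𝓝[>] 0)
      (𝓝 (2 * (m + 1))) := by
    have h : HasDerivAt (fun t : ℝ => (1 + t) ^ (2 * (m + 1))) (2 * (m + 1)) 0 := by
      simpa using ((hasDerivAt_id (0 : ℝ)).const_add 1).fun_pow (2 * (m + 1))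
    simpa using h.tendsto_slope_zero_right
  have hlim := (hslope.inv₀ (by positivity)).const_mul
    ((m + 1).factorial * 2 / (2 * Real.pi) ^ (m + 1))
  convert hlim using 2
  · simp only [rowRatio, div_eq_mul_inv, mul_inv, inv_inv]
    ring
  · rw [Nat.factorial_succ]
    push_cast
    field_simp

theorem rowRatio_mul (ht : 0 < t) (m : ℕ) :
    rowRatio m t * ((((1 + t) ^ (2 * (m + 1)) - 1) *
      (Real.pi ^ (m + 1) / (m + 1).factorial)) * (2 * t) ^ (2 * m + 1)) =
        (2 * t ^ 2) ^ (m + 1) := by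
  have := one_add_pow_sub_one_pos ht m
  rw [rowRatio]
  field_simp
  ring

theorem volume_chartBox_eq_mul (ht : 0 < t) :
    volume (chartBox N t) = ENNReal.ofReal (∏ m ∈ Finset.range N, rowRatio m t) *
      ((∏ k : Fin N, volume (sliceSet t k)) * lebesgueH N (hermBox N t)) := by
  have hodd : N ^ 2 = ∑ m ∈ Finset.range N, (2 * m + 1) := by
    induction N with
    | zero => rfl
    | succ n ih => rw [Finset.sum_range_succ, ← ih]; ring
  have hshell (m : ℕ) := one_add_pow_sub_one_pos ht m
  simp only [volume_chartBox ht.le, volume_sliceSet ht.le, lebesgueH_hermBox ht.le,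
    Finset.prod_mul_distrib, prod_fin_sub_eq_prod_range fun m => ENNReal.ofReal (2 * t ^ 2) ^ m,
    prod_fin_sub_eq_prod_range fun m => ENNReal.ofReal
      (((1 + t) ^ (2 * m) - 1) * (Real.pi ^ m / m.factorial)), hodd, ← Finset.prod_pow_eq_pow_sum]
  rw [← ENNReal.ofReal_prod_of_nonneg fun m _ => by have := hshell m; positivity, mul_assoc,
    mul_left_comm, ← ENNReal.ofReal_mul (Finset.prod_nonneg fun m _ => by
      have := hshell m; positivity), ← ENNReal.ofReal_mul (Finset.prod_nonneg fun m _ =>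
      (rowRatio_pos ht m).le), ← Finset.prod_mul_distrib, ← Finset.prod_mul_distrib]
  simp only [rowRatio_mul ht, ← ENNReal.ofReal_pow (show (0 : ℝ) ≤ 2 * t ^ 2 by positivity)]
  rw [ENNReal.ofReal_prod_of_nonneg fun m _ => by positivity]

theorem volume_chartBox_ne_zero (ht : 0 < t) : volume (chartBox N t) ≠ 0 := by
  rw [volume_chartBox ht.le]
  refine Finset.prod_ne_zero_iff.2 fun j _ => mul_ne_zero
    (pow_ne_zero _ (Metric.measure_closedBall_pos volume 0 ht).ne') (pow_ne_zero _ ?_)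
  exact (ENNReal.ofReal_pos.2 (by positivity)).ne'

theorem haarU_image_hermBox_div (ht : 0 < t) :
    haarU N (expI '' hermBox N t) / lebesgueH N (hermBox N t) =
      volume (lowerExpChart '' chartBox N t : Set (Fin N → Fin N → ℂ)) / volume (chartBox N t) *
        ENNReal.ofReal (∏ m ∈ Finset.range N, rowRatio m t) := by
  have hclosed : IsClosed (expI '' hermBox N t) := (((isCompact_closedBall 0 t).image
    (continuous_hermOfCoords N)).image continuous_expI).isClosed
  have hbox := volume_chartBox_ne_zero (N := N) ht
  rw [volume_chartBox_eq_mul ht] at hbox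
  have hslice : ∏ k : Fin N, volume (sliceSet t k) ≠ ∞ := ENNReal.prod_ne_top fun k _ => by
    rw [volume_sliceSet ht.le]
    exact ENNReal.mul_ne_top (ENNReal.pow_ne_top measure_closedBall_lt_top.ne) ENNReal.ofReal_ne_top
  have himage : (lowerExpChart '' chartBox N t : Set (Fin N → Fin N → ℂ)) = _ :=
    image_lowerExpChart_chartBox N t
  rw [himage, volume_triSet t hclosed, volume_triSet_univ ht.le,
    volume_chartBox_eq_mul ht, mul_comm (ENNReal.ofReal _), mul_comm (haarU N _), mul_assoc,
    ENNReal.mul_div_mul_left _ _ (left_ne_zero_of_mul (right_ne_zero_of_mul hbox)) hslice,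
    ← ENNReal.mul_div_right_comm,
    ENNReal.mul_div_mul_right _ _ (left_ne_zero_of_mul hbox) ENNReal.ofReal_ne_top]

theorem tendsto_volume_image_lowerExpChart_div (N : ℕ) :
    Tendsto (fun t => volume (lowerExpChart '' chartBox N t : Set (Fin N → Fin N → ℂ)) /
      volume (chartBox N t)) (𝓝[>] 0) (𝓝 1) := by
  have hborel : BorelSpace (Fin N → Fin N → ℂ) := inferInstance
  have haar : (volume : Measure (Fin N → Fin N → ℂ)).IsAddHaarMeasure :=
    Measure.pi.isAddHaarMeasure fun _ => volume
  have hlim := @tendsto_addHaar_image_div (Matrix (Fin N) (Fin N) ℂ) _ _ _ MeasurableSpace.pi hborel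
    (volume : Measure (Fin N → Fin N → ℂ)) haar _ _ _ hasStrictFDerivAt_lowerExpChart _ _ _
    tendsto_chartBox_smallSets
    (eventually_mem_nhdsWithin.mono fun t ht => volume_chartBox_ne_zero ht)
  rwa [show |(LinearMap.toContinuousLinearMap (chartDeriv (N := N))).det| = 1 from
    abs_det_chartDeriv, ENNReal.ofReal_one] at hlim

theorem tendsto_haarU_image_hermBox_div (N : ℕ) :
    Tendsto (fun t => haarU N (expI '' hermBox N t) / lebesgueH N (hermBox N t)) (𝓝[>] 0)
      (𝓝 (ENNReal.ofReal (constC N))) := by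
  have hratio : Tendsto (fun t => ENNReal.ofReal (∏ m ∈ Finset.range N, rowRatio m t)) (𝓝[>] 0)
      (𝓝 (ENNReal.ofReal (constC N))) := by
    rw [constC_eq_prod]
    exact ENNReal.tendsto_ofReal (tendsto_finsetProd _ fun m _ => tendsto_rowRatio m)
  have hlim := ENNReal.Tendsto.mul (tendsto_volume_image_lowerExpChart_div N) (.inl one_ne_zero)
    hratio (.inr ENNReal.one_ne_top)
  rw [one_mul] at hlim
  exact hlim.congr' (eventually_mem_nhdsWithin.mono fun t ht => (haarU_image_hermBox_div ht).symm)

theorem haarU_eq_smul (N : ℕ) : haarU N = (constC N).toNNReal • μHE[N ^ 2] := by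
  obtain ⟨c, hc⟩ := exists_haarU_eq_smul N
  obtain ⟨C, hC⟩ := hermBox_subset_closedBall N
  have hzero : Tendsto (fun t => C * t) (𝓝[>] 0) (𝓝 0) :=
    Tendsto.mono_left (by simpa using (continuous_const_mul C).tendsto 0) nhdsWithin_le_nhds
  have hpos : ∀ᶠ t in 𝓝[>] (0 : ℝ), lebesgueH N (hermBox N t) ≠ 0 := by
    filter_upwards [self_mem_nhdsWithin] with t ht
    rw [lebesgueH_hermBox (mem_Ioi.1 ht).le]
    have := mem_Ioi.1 ht
    exact (ENNReal.ofReal_pos.2 (by positivity)).ne'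
  have huniq := tendsto_nhds_unique (tendsto_haarU_image_expI_div hc hzero hC hpos)
    (tendsto_haarU_image_hermBox_div N)
  rwa [← ENNReal.coe_injective huniq]

end HaarDensity

section ProductMeasure

variable {ι α β : Type*} [Fintype ι] [MeasurableSpace α] [MeasurableSpace β]

theorem measure_pi_mono {α : ι → Type*} [∀ i, MeasurableSpace (α i)] {μ ν : ∀ i, Measure (α i)}
    [∀ i, SigmaFinite (μ i)] (h : ∀ i, μ i ≤ ν i) : Measure.pi μ ≤ Measure.pi ν := by
  have hle : (Measure.pi μ).toOuterMeasure ≤ OuterMeasure.pi fun i => (ν i).toOuterMeasure := by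
    refine OuterMeasure.le_pi.2 fun s _ => ?_
    change Measure.pi μ (univ.pi s) ≤ _
    rw [pi_pi]
    exact Finset.prod_le_prod' fun i _ => h i (s i)
  refine Measure.le_iff.2 fun s hs => ?_
  conv_rhs => rw [Measure.pi, toMeasure_apply _ _ hs]
  exact hle s

theorem measure_pi_const_smul (a : ℝ≥0) (μ : Measure α) [SigmaFinite μ] :
    Measure.pi (fun _ : ι => a • μ) = a ^ Fintype.card ι • Measure.pi (fun _ : ι => μ) := by
  refine pi_eq fun s _ => ?_
  simp only [Measure.smul_apply, pi_pi, ENNReal.smul_def, smul_eq_mul, Finset.prod_mul_distrib,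
    Finset.prod_const, Finset.card_univ, ENNReal.coe_pow]

section Pushforward

variable {μ : Measure α} {ν : Measure β} [SigmaFinite μ] [SigmaFinite ν] {s : Set α} {t : Set β}
  {g : α → β} [SigmaFinite ((μ.restrict s).map g)] {f : (ι → β) → ℝ≥0∞} {c : ℝ≥0}

theorem lintegral_pi_map_restrict (hg : Measurable g) (hf : Measurable f) :
    ∫⁻ y, f y ∂(Measure.pi fun _ => (μ.restrict s).map g) =
      ∫⁻ x in univ.pi fun _ => s, f (fun i => g (x i)) ∂(Measure.pi fun _ => μ) := by
  rw [restrict_pi_pi, ← pi_map_pi fun _ => hg.aemeasurable, lintegral_map hf (by fun_prop)]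

theorem pow_mul_setLIntegral_pi_comp_le (hg : Measurable g) (hf : Measurable f)
    (h : c • (μ.restrict s).map g ≤ ν.restrict t) :
    (c : ℝ≥0∞) ^ Fintype.card ι *
        ∫⁻ x in univ.pi fun _ => s, f (fun i => g (x i)) ∂(Measure.pi fun _ => μ) ≤
      ∫⁻ y in univ.pi fun _ => t, f y ∂(Measure.pi fun _ => ν) := by
  have hle := lintegral_mono' (measure_pi_mono fun _ : ι => h) (le_refl f)
  rwa [measure_pi_const_smul, lintegral_smul_measure, ENNReal.smul_def, ENNReal.coe_pow,
    lintegral_pi_map_restrict hg hf, ← restrict_pi_pi, smul_eq_mul] at hle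

theorem setLIntegral_pi_le_pow_mul_comp (hg : Measurable g) (hf : Measurable f)
    (h : ν.restrict t ≤ c • (μ.restrict s).map g) :
    ∫⁻ y in univ.pi fun _ => t, f y ∂(Measure.pi fun _ => ν) ≤ (c : ℝ≥0∞) ^ Fintype.card ι *
      ∫⁻ x in univ.pi fun _ => s, f (fun i => g (x i)) ∂(Measure.pi fun _ => μ) := by
  have hle := lintegral_mono' (measure_pi_mono fun _ : ι => h) (le_refl f)
  rwa [measure_pi_const_smul, lintegral_smul_measure, ENNReal.smul_def, ENNReal.coe_pow,
    lintegral_pi_map_restrict hg hf, ← restrict_pi_pi, smul_eq_mul] at hle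

end Pushforward

end ProductMeasure

section LocalComparison

variable {N : ℕ} {r : ℝ}

theorem constC_pos (N : ℕ) : 0 < constC N :=
  div_pos (Finset.prod_pos fun _ _ => by positivity) (by positivity)

instance isFiniteMeasure_restrict_ballH (r : ℝ) :
    IsFiniteMeasure ((lebesgueH N).restrict (ballH 0 r)) := by
  refine ⟨?_⟩
  rw [Measure.restrict_apply_univ, ballH_eq_closedBall, lebesgueH_closedBall]
  exact measure_closedBall_lt_top

theorem map_expI_restrict_ballH_apply {S : Set (UGroup N)} (hS : MeasurableSet S) (r : ℝ) :
    ((lebesgueH N).restrict (ballH 0 r)).map expI S = lebesgueH N (expI ⁻¹' S ∩ ballH 0 r) := by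
  rw [Measure.map_apply continuous_expI.measurable hS,
    Measure.restrict_apply (continuous_expI.measurable hS)]

theorem preimage_inter_ballH_subset (S : Set (UGroup N)) (r : ℝ) :
    expI ⁻¹' S ∩ ballH 0 r ⊆ Metric.closedBall 0 r :=
  inter_subset_right.trans (ballH_eq_closedBall _ _).subset

theorem exp_six_mul_lt_two (hr : r ≤ 1 / 24) : Real.exp (6 * r) < 2 := by
  linarith [Real.exp_le_exp.2 (show 6 * r ≤ 1 / 4 by linarith), exp_one_quarter_lt]

theorem smul_map_expI_le_haarU_restrict (hr : 0 ≤ r) (hr' : r ≤ 1 / 24) :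
    ((2 - Real.exp (6 * r)) ^ N ^ 2 * constC N).toNNReal •
      ((lebesgueH N).restrict (ballH 0 r)).map expI ≤ (haarU N).restrict (ballU 1 (2 * r)) := by
  have hexp : Real.exp r ≤ Real.exp (6 * r) := Real.exp_le_exp.2 (by linarith)
  have hexp' : Real.exp (6 * r) < 2 := exp_six_mul_lt_two hr'
  refine Measure.le_iff.2 fun S hS => ?_
  set A := expI ⁻¹' S ∩ ballH (0 : Herm N) r
  have hA : expI '' A ⊆ S ∩ ballU 1 (2 * r) := by
    rw [image_preimage_inter]
    exact inter_subset_inter_right S (image_expI_ballH_subset (by linarith))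
  rw [Measure.smul_apply, map_expI_restrict_ballH_apply hS, Measure.restrict_apply hS]
  calc ENNReal.ofReal ((2 - Real.exp (6 * r)) ^ N ^ 2 * constC N) * lebesgueH N A
      ≤ ENNReal.ofReal (constC N * (2 - Real.exp r) ^ N ^ 2) * lebesgueH N A := by
        rw [mul_comm (_ ^ _)]
        have := (constC_pos N).le
        have := sub_nonneg.2 hexp'.le
        gcongr ENNReal.ofReal (_ * (2 - ?_) ^ _) * _
    _ = ENNReal.ofReal (constC N) * (ENNReal.ofReal (2 - Real.exp r) ^ N ^ 2 * lebesgueH N A) := by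
        rw [ENNReal.ofReal_mul (constC_pos N).le, ENNReal.ofReal_pow (by linarith), mul_assoc]
    _ ≤ ENNReal.ofReal (constC N) * μHE[N ^ 2] (expI '' A) := by
        gcongr
        exact le_euclideanHausdorffMeasure_image_expI (hexp.trans_lt hexp')
          (preimage_inter_ballH_subset S r)
    _ = haarU N (expI '' A) := by rw [haarU_eq_smul]; rfl
    _ ≤ haarU N (S ∩ ballU 1 (2 * r)) := measure_mono hA

theorem haarU_restrict_le_smul_map_expI (hr : 0 ≤ r)
    (hball : ballU (1 : UGroup N) (2 * r) ⊆ expI '' ballH 0 (3 * r)) :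
    (haarU N).restrict (ballU 1 (2 * r)) ≤ (Real.exp (6 * r * N ^ 2) * constC N).toNNReal •
      ((lebesgueH N).restrict (ballH 0 (3 * r))).map expI := by
  have hexp : Real.exp (3 * r) ^ N ^ 2 ≤ Real.exp (6 * r * N ^ 2) := by
    rw [← Real.exp_nat_mul, Nat.cast_pow]
    exact Real.exp_le_exp.2 (by nlinarith [mul_nonneg hr (sq_nonneg (N : ℝ))])
  refine Measure.le_iff.2 fun S hS => ?_
  set A := expI ⁻¹' S ∩ ballH (0 : Herm N) (3 * r)
  have hA : S ∩ ballU 1 (2 * r) ⊆ expI '' A := by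
    rw [image_preimage_inter]
    exact inter_subset_inter_right S hball
  rw [Measure.smul_apply, map_expI_restrict_ballH_apply hS, Measure.restrict_apply hS]
  calc haarU N (S ∩ ballU 1 (2 * r))
      ≤ haarU N (expI '' A) := measure_mono hA
    _ = ENNReal.ofReal (constC N) * μHE[N ^ 2] (expI '' A) := by rw [haarU_eq_smul]; rfl
    _ ≤ ENNReal.ofReal (constC N) *
          (ENNReal.ofReal (Real.exp (3 * r)) ^ N ^ 2 * lebesgueH N A) := by
        gcongr
        exact euclideanHausdorffMeasure_image_expI_le (preimage_inter_ballH_subset S (3 * r))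
    _ = ENNReal.ofReal (Real.exp (3 * r) ^ N ^ 2 * constC N) * lebesgueH N A := by
        rw [mul_comm (Real.exp _ ^ _), ENNReal.ofReal_mul (constC_pos N).le,
          ENNReal.ofReal_pow (Real.exp_nonneg _), mul_assoc]
    _ ≤ ENNReal.ofReal (Real.exp (6 * r * N ^ 2) * constC N) * lebesgueH N A := by
        have := (constC_pos N).le
        gcongr

theorem exists_haarU_restrict_bounds (N : ℕ) : ∃ r₀ : ℝ, 0 < r₀ ∧ r₀ ≤ 1 / 24 ∧
    ∀ r : ℝ, 0 ≤ r → r ≤ r₀ →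
      ((2 - Real.exp (6 * r)) ^ N ^ 2 * constC N).toNNReal •
          ((lebesgueH N).restrict (ballH 0 r)).map expI ≤ (haarU N).restrict (ballU 1 (2 * r)) ∧
      (haarU N).restrict (ballU 1 (2 * r)) ≤ (Real.exp (6 * r * N ^ 2) * constC N).toNNReal •
          ((lebesgueH N).restrict (ballH 0 (3 * r))).map expI := by
  obtain ⟨η, hη, hball⟩ := exists_ballU_subset_image_expI N
  refine ⟨min η (1 / 24), by positivity, min_le_right _ _, fun r hr hr' => ?_⟩
  obtain ⟨hrη, hr24⟩ := le_min_iff.1 hr'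
  exact ⟨smul_map_expI_le_haarU_restrict hr hr24, haarU_restrict_le_smul_map_expI hr (hball r hrη)⟩

end LocalComparison

end LieIntegration

end

theorem theorem10p1 (N : ℕ) (hN : 1 ≤ N) :
    ∃ r₀ : ℝ, 0 < r₀ ∧
      (∀ f : UGroup N → ℝ≥0, Measurable f → ∀ r : ℝ, 0 < r → r ≤ r₀ →
        ENNReal.ofReal ((2 - Real.exp (6 * r)) ^ (N ^ 2) * constC N) *
            ∫⁻ H in ballH 0 r, (f (expI H) : ℝ≥0∞) ∂(lebesgueH N)
          ≤ ∫⁻ U in ballU 1 (2 * r), (f U : ℝ≥0∞) ∂(haarU N) ∧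
        ∫⁻ U in ballU 1 (2 * r), (f U : ℝ≥0∞) ∂(haarU N)
          ≤ ENNReal.ofReal (Real.exp (6 * r * N ^ 2) * constC N) *
            ∫⁻ H in ballH 0 (3 * r), (f (expI H) : ℝ≥0∞) ∂(lebesgueH N)) ∧
      (∀ n : ℕ, 1 ≤ n → ∀ f : (Fin n → UGroup N) → ℝ≥0, Measurable f →
        ∀ r : ℝ, 0 < r → r ≤ r₀ →
        ENNReal.ofReal ((2 - Real.exp (6 * r)) ^ (N ^ 2 * n) * constC N ^ n) *
            ∫⁻ H in Set.univ.pi (fun _ : Fin n => ballH 0 r),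
              (f (fun i => expI (H i)) : ℝ≥0∞) ∂(Measure.pi fun _ : Fin n => lebesgueH N)
          ≤ ∫⁻ U in Set.univ.pi (fun _ : Fin n => ballU 1 (2 * r)),
              (f U : ℝ≥0∞) ∂(Measure.pi fun _ : Fin n => haarU N) ∧
        ∫⁻ U in Set.univ.pi (fun _ : Fin n => ballU 1 (2 * r)),
              (f U : ℝ≥0∞) ∂(Measure.pi fun _ : Fin n => haarU N)
          ≤ ENNReal.ofReal (Real.exp (6 * r * N ^ 2 * n) * constC N ^ n) *
            ∫⁻ H in Set.univ.pi (fun _ : Fin n => ballH 0 (3 * r)),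
              (f (fun i => expI (H i)) : ℝ≥0∞) ∂(Measure.pi fun _ : Fin n => lebesgueH N)) := by
  obtain ⟨r₀, hr₀, hr₀', hbounds⟩ := exists_haarU_restrict_bounds N
  have hexpI : Measurable (expI (N := N)) := continuous_expI.measurable
  have hC : 0 < constC N := constC_pos N
  refine ⟨r₀, hr₀, fun f hf r hr hr' => ?_, fun n _ f hf r hr hr' => ?_⟩ <;>
    obtain ⟨hlow, hupp⟩ := hbounds r hr.le hr'
  · have hlow' := lintegral_mono' hlow (le_refl fun U => (f U : ℝ≥0∞))
    have hupp' := lintegral_mono' hupp (le_refl fun U => (f U : ℝ≥0∞))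
    rw [lintegral_smul_measure, lintegral_map hf.coe_nnreal_ennreal hexpI] at hlow' hupp'
    exact ⟨hlow', hupp'⟩
  · have hlow' := pow_mul_setLIntegral_pi_comp_le (ι := Fin n) hexpI hf.coe_nnreal_ennreal hlow
    have hupp' := setLIntegral_pi_le_pow_mul_comp (ι := Fin n) hexpI hf.coe_nnreal_ennreal hupp
    have hexp : 0 < 2 - Real.exp (6 * r) := sub_pos.2 (exp_six_mul_lt_two (hr'.trans hr₀'))
    rw [Fintype.card_fin, ← ENNReal.coe_pow, ← Real.toNNReal_pow (by positivity), mul_pow]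
      at hlow' hupp'
    rw [← pow_mul] at hlow'
    rw [← Real.exp_nat_mul, mul_comm (n : ℝ)] at hupp'
    exact ⟨hlow', hupp'⟩
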